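/- Let $M$ be a connected smooth ($C^\infty$, Hausdorff, second countable, without boundary) manifold of dimension $n$, and let $A$ be a second order linear differential operator on $M$ which is locally uniformly elliptic with locally bounded coefficients; that is, in local coordinates $(x_1,\dots,x_n)$, $$A=\sum_{i,j=1}^n a_{ij}\frac{\partial^2}{\partial x_i\partial x_j}+\sum_{i=1}^n b_i\frac{\partial}{\partial x_i}+c,$$ where $a_{ij}$, $b_i$ and $c$ are locally bounded real-valued functions (not necessarily continuous) and $(a_{ij})$ is a symmetric matrix-valued function whose eigenvalues are locally bounded below by a positive constant. Let $K$ be a closed subset of $M$ such that each connected component of $M\setminus K$ contains a connected noncompact closed subset of $M$, and let $D\subset M\setminus K$ be a closed subset of $M$ with no compact connected components. Then, for every positive continuous real-valued function $\rho$ on $M$, there is a $C^\infty$ function $\varphi\colon M\to\mathbb R$ such that 1. $\varphi\ge 0$ and $A\varphi\ge 0$ on $M$; 2. $\varphi>\rho$ and $A\varphi>\rho$ on $D$; 3. $\varphi\equiv 0$ on $K$; 4. $\varphi>0$ on $M\setminus K$; and 5. for each compact set $E\subset M\setminus K$ there is a constant $\delta=\delta(\varphi,E)>0$ with $A\varphi>\delta$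 on $E$. -/

import Mathlib

open scoped Manifold ContDiff Topology Matrix

noncomputable section

/-- The partial derivative `∂u/∂xᵢ` of a real function on `ℝⁿ`. -/
def partialDeriv {n : ℕ} (i : Fin n) (u : EuclideanSpace ℝ (Fin n) → ℝ) :
    EuclideanSpace ℝ (Fin n) → ℝ :=
  fun y => fderiv ℝ u y (EuclideanSpace.single i 1)

/-- In the local coordinates given by the chart `e`, the operator `A` is
`∑ aᵢⱼ ∂²/∂xᵢ∂xⱼ + ∑ bᵢ ∂/∂xᵢ + c`, where the coefficients are locally bounded on the domain of
`e` (no continuity or measurability is required), and `(aᵢⱼ)` is symmetric and locally bounded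
below there by a positive multiple of the identity matrix. Only the values of `a`, `b`, `c` on
`e.source` matter. -/
structure HasEllipticForm {n : ℕ} {M : Type*} [TopologicalSpace M]
    [ChartedSpace (EuclideanSpace ℝ (Fin n)) M]
    (A : C^∞⟮𝓡 n, M; ℝ⟯ → M → ℝ)
    (e : OpenPartialHomeomorph M (EuclideanSpace ℝ (Fin n)))
    (a : M → Matrix (Fin n) (Fin n) ℝ) (b : M → Fin n → ℝ) (c : M → ℝ) : Prop where
  apply_eq : ∀ (f : C^∞⟮𝓡 n, M; ℝ⟯), ∀ x ∈ e.source,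
    A f x = (∑ i, ∑ j, a x i j * partialDeriv i (partialDeriv j (f ∘ e.symm)) (e x))
      + (∑ i, b x i * partialDeriv i (f ∘ e.symm) (e x)) + c x * f x
  isSymm : ∀ x ∈ e.source, (a x).IsSymm
  locallyBounded : ∀ x ∈ e.source, ∃ V ∈ 𝓝 x, ∃ B : ℝ, ∀ y ∈ V ∩ e.source,
    (∀ i j, |a y i j| ≤ B) ∧ (∀ i, |b y i| ≤ B) ∧ |c y| ≤ B
  locallyElliptic : ∀ x ∈ e.source, ∃ V ∈ 𝓝 x, ∃ δ : ℝ, 0 < δ ∧ ∀ y ∈ V ∩ e.source,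
    ∀ ξ : Fin n → ℝ, δ * (ξ ⬝ᵥ ξ) ≤ ξ ⬝ᵥ (a y *ᵥ ξ)

/-- `A` is a second order, locally uniformly elliptic, linear differential operator with locally
bounded real coefficients on the smooth manifold `M`: every point lies in the domain of a smooth
chart in which `A` has such a form. -/
def IsLocallyUniformlyElliptic {n : ℕ} {M : Type*} [TopologicalSpace M]
    [ChartedSpace (EuclideanSpace ℝ (Fin n)) M]
    (A : C^∞⟮𝓡 n, M; ℝ⟯ → M → ℝ) : Prop :=
  ∀ p : M, ∃ e ∈ IsManifold.maximalAtlas (𝓡 n) ∞ M, p ∈ e.source ∧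
    ∃ (a : M → Matrix (Fin n) (Fin n) ℝ) (b : M → Fin n → ℝ) (c : M → ℝ),
      HasEllipticForm A e a b c

end

/-! The obstruction to a nonnegative compactly supported subsolution can be confined to a small set
and then pushed to infinity. In a chart, exp(-l / (R² - |y - q|²)), extended by zero, satisfies `A α
≥ 0` off any prescribed neighbourhood of its centre once `l` is large: near the boundary and away
from `q` the term of order l² in the quadratic form of (aᵢⱼ) dominates everything else, including a
zero order coefficient of either sign. This gives the cells of `exists_isCell`. Along a locally
finite chain of overlapping cells the bad set of each bump is placed in the overlap with the next
cell, and these bad sets are made disjoint. The next bump, with a large enough coefficient,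
compensates for the failure there, and since the chain never ends nothing is left over
(`exists_subsolution_of_chain`). Noncompactness provides the chains. If a closed set has no compact
component, then the intersection graph of a locally finite cover of it by cells has infinite
components. A form of König's lemma gives a ray from every cell, and the rays can be chosen so that
each cell meets only finitely many (`exists_locallyFinite_rays`). Summing the resulting functions
with large coefficients yields a function exceeding ρ on `D` (`exists_subsolution_large_on`). For
positivity off `K`, each point is joined by a path to a closed connected noncompact set in its
component, so some subsolution is large near it. Countably many of these are added with rapidly
decreasing coefficients (`exists_pos_hasSum`); this sum need not be locally finite, so convergence
of all derivatives is arranged instead. -/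

/-! ### Partial derivatives and second order operators on ℝⁿ. -/

section PartialDeriv

variable {n : ℕ} {u v : EuclideanSpace ℝ (Fin n) → ℝ} {y : EuclideanSpace ℝ (Fin n)}

lemma Filter.EventuallyEq.partialDeriv (h : u =ᶠ[𝓝 y] v) (i : Fin n) :
    partialDeriv i u =ᶠ[𝓝 y] partialDeriv i v :=
  (h.fderiv (𝕜 := ℝ)).mono fun z hz => by simp only [_root_.partialDeriv, hz]

lemma ContDiffAt.partialDeriv (h : ContDiffAt ℝ ∞ u y) (i : Fin n) :
    ContDiffAt ℝ ∞ (partialDeriv i u) y :=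
  (h.fderiv_right (m := ∞) (by simp)).clm_apply contDiffAt_const

lemma ContDiffAt.eventually_differentiableAt (h : ContDiffAt ℝ ∞ u y) :
    ∀ᶠ z in 𝓝 y, DifferentiableAt ℝ u z :=
  ((h.of_le (by simp : (1 : WithTop ℕ∞) ≤ ∞)).eventually (by simp)).mono
    fun _ hz => hz.differentiableAt (by simp)

/-- Equality of germs, rather than of values, is what allows a second differentiation in
`secondOrder_add`. -/
lemma partialDeriv_add_eventuallyEq (hu : ContDiffAt ℝ ∞ u y) (hv : ContDiffAt ℝ ∞ v y)
    (i : Fin n) :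
    partialDeriv i (u + v) =ᶠ[𝓝 y] partialDeriv i u + partialDeriv i v := by
  filter_upwards [hu.eventually_differentiableAt, hv.eventually_differentiableAt] with z h1 h2
  simp [partialDeriv, fderiv_add h1 h2]

lemma partialDeriv_const_smul_eventuallyEq (hu : ContDiffAt ℝ ∞ u y) (k : ℝ) (i : Fin n) :
    partialDeriv i (k • u) =ᶠ[𝓝 y] k • partialDeriv i u := by
  filter_upwards [hu.eventually_differentiableAt] with z h1
  simp [partialDeriv, fderiv_const_smul h1]

/-- The second order operator with constant coefficients `a`, `b`, `c`. -/
noncomputable def secondOrder (a : Matrix (Fin n) (Fin n) ℝ) (b : Fin n → ℝ) (c : ℝ)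
    (u : EuclideanSpace ℝ (Fin n) → ℝ) (y : EuclideanSpace ℝ (Fin n)) : ℝ :=
  (∑ i, ∑ j, a i j * partialDeriv i (partialDeriv j u) y)
    + (∑ i, b i * partialDeriv i u y) + c * u y

variable (a : Matrix (Fin n) (Fin n) ℝ) (b : Fin n → ℝ) (c : ℝ)

lemma secondOrder_congr (h : u =ᶠ[𝓝 y] v) : secondOrder a b c u y = secondOrder a b c v y := by
  have h2 : ∀ i j, partialDeriv i (partialDeriv j u) y = partialDeriv i (partialDeriv j v) y :=
    fun i j => ((h.partialDeriv j).partialDeriv i).eq_of_nhds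
  have h1 : ∀ i, partialDeriv i u y = partialDeriv i v y :=
    fun i => (h.partialDeriv i).eq_of_nhds
  simp only [secondOrder, h2, h1, h.eq_of_nhds]

lemma secondOrder_add (hu : ContDiffAt ℝ ∞ u y) (hv : ContDiffAt ℝ ∞ v y) :
    secondOrder a b c (u + v) y = secondOrder a b c u y + secondOrder a b c v y := by
  have h1 : ∀ i, partialDeriv i (u + v) y = partialDeriv i u y + partialDeriv i v y :=
    fun i => (partialDeriv_add_eventuallyEq hu hv i).eq_of_nhds
  have h2 : ∀ i j, partialDeriv i (partialDeriv j (u + v)) y =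
      partialDeriv i (partialDeriv j u) y + partialDeriv i (partialDeriv j v) y := fun i j =>
    (((partialDeriv_add_eventuallyEq hu hv j).partialDeriv i).trans
      (partialDeriv_add_eventuallyEq (hu.partialDeriv j) (hv.partialDeriv j) i)).eq_of_nhds
  simp only [secondOrder, h2, h1, mul_add, Finset.sum_add_distrib, Pi.add_apply]
  ring

lemma secondOrder_const_smul (hu : ContDiffAt ℝ ∞ u y) (k : ℝ) :
    secondOrder a b c (k • u) y = k * secondOrder a b c u y := by
  have h1 : ∀ i, partialDeriv i (k • u) y = k * partialDeriv i u y :=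
    fun i => (partialDeriv_const_smul_eventuallyEq hu k i).eq_of_nhds
  have h2 : ∀ i j, partialDeriv i (partialDeriv j (k • u)) y =
      k * partialDeriv i (partialDeriv j u) y := fun i j =>
    (((partialDeriv_const_smul_eventuallyEq hu k j).partialDeriv i).trans
      (partialDeriv_const_smul_eventuallyEq (hu.partialDeriv j) k i)).eq_of_nhds
  simp only [secondOrder, h2, h1, mul_add, Finset.mul_sum, Pi.smul_apply, smul_eq_mul]
  congr 1
  · congr 1
    · exact Finset.sum_congr rfl fun i _ => Finset.sum_congr rfl fun j _ => by ring
    · exact Finset.sum_congr rfl fun i _ => by ring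
  · ring

lemma abs_secondOrder_le {B C : ℝ} (ha : ∀ i j, |a i j| ≤ B) (hb : ∀ i, |b i| ≤ B) (hc : |c| ≤ B)
    (h2 : ∀ i j, |partialDeriv i (partialDeriv j u) y| ≤ C) (h1 : ∀ i, |partialDeriv i u y| ≤ C)
    (h0 : |u y| ≤ C) :
    |secondOrder a b c u y| ≤ n * (n * (B * C)) + n * (B * C) + B * C := by
  have hB : 0 ≤ B := (abs_nonneg c).trans hc
  have key : ∀ s t : ℝ, |s| ≤ B → |t| ≤ C → |s * t| ≤ B * C := fun s t hs ht => by
    rw [abs_mul]; exact mul_le_mul hs ht (abs_nonneg _) hB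
  refine (abs_add_le _ _).trans (add_le_add ((abs_add_le _ _).trans (add_le_add ?_ ?_))
    (key _ _ hc h0))
  · refine (Finset.abs_sum_le_sum_abs _ _).trans ((Finset.sum_le_sum (g := fun _ => n * (B * C))
      fun i _ => ?_).trans (by simp))
    exact (Finset.abs_sum_le_sum_abs _ _).trans ((Finset.sum_le_sum (g := fun _ => B * C)
      fun j _ => key _ _ (ha i j) (h2 i j)).trans (by simp))
  · exact (Finset.abs_sum_le_sum_abs _ _).trans ((Finset.sum_le_sum (g := fun _ => B * C)
      fun i _ => key _ _ (hb i) (h1 i)).trans (by simp))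

end PartialDeriv

/-! ### Locality, linearity and local bounds for the operator. -/

section Operator

lemma comp_chart_symm_eventuallyEq {n : ℕ} {M : Type*} [TopologicalSpace M]
    {e : OpenPartialHomeomorph M (EuclideanSpace ℝ (Fin n))} {f g : M → ℝ} {x : M} (hx : x ∈ e.source)
    (h : f =ᶠ[𝓝 x] g) : f ∘ e.symm =ᶠ[𝓝 (e x)] g ∘ e.symm := by
  have := (e.continuousAt_symm (e.map_source hx))
  rw [ContinuousAt, e.left_inv hx] at this
  exact this.eventually h

variable {n : ℕ} {M : Type*} [TopologicalSpace M]
    [ChartedSpace (EuclideanSpace ℝ (Fin n)) M]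
    {A : C^∞⟮𝓡 n, M; ℝ⟯ → M → ℝ}
    {e : OpenPartialHomeomorph M (EuclideanSpace ℝ (Fin n))}

lemma contDiffAt_comp_chart_symm [IsManifold (𝓡 n) ∞ M]
    (he : e ∈ IsManifold.maximalAtlas (𝓡 n) ∞ M) {f : M → ℝ} (hf : ContMDiff (𝓡 n) 𝓘(ℝ) ∞ f)
    {y : EuclideanSpace ℝ (Fin n)} (hy : y ∈ e.target) : ContDiffAt ℝ ∞ (f ∘ e.symm) y := by
  have h := hf.comp_contMDiffOn (contMDiffOn_symm_of_mem_maximalAtlas he)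
  exact ((contMDiffOn_iff_contDiffOn.1 h) y hy).contDiffAt (e.open_target.mem_nhds hy)

lemma HasEllipticForm.apply_eq_secondOrder {a b c} (h : HasEllipticForm A e a b c)
    (f : C^∞⟮𝓡 n, M; ℝ⟯) {x : M} (hx : x ∈ e.source) :
    A f x = secondOrder (a x) (b x) (c x) (f ∘ e.symm) (e x) := by
  rw [h.apply_eq f x hx, secondOrder]
  simp [e.left_inv hx]

namespace IsLocallyUniformlyElliptic

lemma congr_of_eventuallyEq (hA : IsLocallyUniformlyElliptic A) {f g : C^∞⟮𝓡 n, M; ℝ⟯} {x : M}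
    (h : f =ᶠ[𝓝 x] g) : A f x = A g x := by
  obtain ⟨e, he, hx, a, b, c, hf⟩ := hA x
  rw [hf.apply_eq_secondOrder f hx, hf.apply_eq_secondOrder g hx]
  exact secondOrder_congr _ _ _ (comp_chart_symm_eventuallyEq hx h)

variable [IsManifold (𝓡 n) ∞ M]

lemma map_add (hA : IsLocallyUniformlyElliptic A) (f g : C^∞⟮𝓡 n, M; ℝ⟯) (x : M) :
    A (f + g) x = A f x + A g x := by
  obtain ⟨e, he, hx, a, b, c, hf⟩ := hA x
  simp only [hf.apply_eq_secondOrder _ hx]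
  exact secondOrder_add _ _ _ (contDiffAt_comp_chart_symm he f.contMDiff (e.map_source hx))
    (contDiffAt_comp_chart_symm he g.contMDiff (e.map_source hx))

lemma map_smul (hA : IsLocallyUniformlyElliptic A) (k : ℝ) (f : C^∞⟮𝓡 n, M; ℝ⟯) (x : M) :
    A (k • f) x = k * A f x := by
  obtain ⟨e, he, hx, a, b, c, hf⟩ := hA x
  simp only [hf.apply_eq_secondOrder _ hx]
  exact secondOrder_const_smul _ _ _
    (contDiffAt_comp_chart_symm he f.contMDiff (e.map_source hx)) k

lemma map_zero (hA : IsLocallyUniformlyElliptic A) (x : M) : A 0 x = 0 := by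
  simpa using hA.map_smul 0 0 x

lemma map_sum (hA : IsLocallyUniformlyElliptic A) {ι : Type*} (s : Finset ι)
    (f : ι → C^∞⟮𝓡 n, M; ℝ⟯) (x : M) : A (∑ i ∈ s, f i) x = ∑ i ∈ s, A (f i) x := by
  classical
  induction s using Finset.induction_on with
  | empty => simpa using hA.map_zero x
  | insert i s hi ih => rw [Finset.sum_insert hi, Finset.sum_insert hi, hA.map_add, ih]

lemma eq_zero_of_eventuallyEq (hA : IsLocallyUniformlyElliptic A) {f : C^∞⟮𝓡 n, M; ℝ⟯} {x : M}
    (h : ∀ᶠ y in 𝓝 x, f y = 0) : A f x = 0 := by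
  rw [← hA.map_zero x]
  exact hA.congr_of_eventuallyEq h

/-- The coefficients need not be continuous, so neither need `A f`; bounded coefficients times
continuous derivatives still give local bounds. These supply the constant `m` of a cell. -/
lemma locallyBounded_apply (hA : IsLocallyUniformlyElliptic A) (f : C^∞⟮𝓡 n, M; ℝ⟯) (x : M) :
    ∃ V ∈ 𝓝 x, ∃ m : ℝ, ∀ y ∈ V, |A f y| ≤ m := by
  obtain ⟨e, he, hx, a, b, c, hf⟩ := hA x
  obtain ⟨V, hV, B, hB⟩ := hf.locallyBounded x hx
  have hu := contDiffAt_comp_chart_symm he f.contMDiff (e.map_source hx)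
  have bd : ∀ w : EuclideanSpace ℝ (Fin n) → ℝ, ContDiffAt ℝ ∞ w (e x) →
      ∀ᶠ C : ℝ in Filter.atTop, ∀ᶠ y in 𝓝 x, |w (e y)| ≤ C := fun w hw => by
    filter_upwards [Filter.eventually_ge_atTop (|w (e x)| + 1)] with C hC
    have : ContinuousAt (fun y => |w (e y)|) x :=
      (hw.continuousAt.comp (e.continuousAt hx)).abs
    filter_upwards [this.eventually (gt_mem_nhds (lt_add_one _))] with y hy
    exact hy.le.trans hC
  have h2 : ∀ᶠ C : ℝ in Filter.atTop, ∀ i j, ∀ᶠ y in 𝓝 x,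
      |partialDeriv i (partialDeriv j (f ∘ e.symm)) (e y)| ≤ C :=
    Filter.eventually_all.2 fun i => Filter.eventually_all.2 fun j =>
      bd _ ((hu.partialDeriv j).partialDeriv i)
  have h1 : ∀ᶠ C : ℝ in Filter.atTop, ∀ i, ∀ᶠ y in 𝓝 x,
      |partialDeriv i (f ∘ e.symm) (e y)| ≤ C :=
    Filter.eventually_all.2 fun i => bd _ (hu.partialDeriv i)
  obtain ⟨C, hC2, hC1, hC0⟩ := (h2.and (h1.and (bd _ hu))).exists
  have : ∀ᶠ y in 𝓝 x, |A f y| ≤ n * (n * (B * C)) + n * (B * C) + B * C := by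
    filter_upwards [hV, e.open_source.mem_nhds hx,
      Filter.eventually_all.2 fun i => Filter.eventually_all.2 (hC2 i),
      Filter.eventually_all.2 hC1, hC0] with y hyV hys q2 q1 q0
    obtain ⟨ba, bb, bc⟩ := hB y ⟨hyV, hys⟩
    rw [hf.apply_eq_secondOrder f hys]
    exact abs_secondOrder_le _ _ _ ba bb bc q2 q1 q0
  exact ⟨_, this, _, fun y hy => hy⟩

lemma exists_abs_le_of_isCompact (hA : IsLocallyUniformlyElliptic A) (f : C^∞⟮𝓡 n, M; ℝ⟯)
    {Q : Set M} (hQ : IsCompact Q) : ∃ m : ℝ, ∀ y ∈ Q, |A f y| ≤ m := by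
  refine hQ.induction_on (p := fun Q => ∃ m : ℝ, ∀ y ∈ Q, |A f y| ≤ m) ⟨0, by simp⟩
    (fun s t hst ⟨m, hm⟩ => ⟨m, fun y hy => hm y (hst hy)⟩)
    (fun s t ⟨m, hm⟩ ⟨k, hk⟩ => ⟨max m k, ?_⟩) fun x _ => ?_
  · rintro y (hy | hy)
    · exact (hm y hy).trans (le_max_left _ _)
    · exact (hk y hy).trans (le_max_right _ _)
  · obtain ⟨V, hV, m, hm⟩ := hA.locallyBounded_apply f x
    exact ⟨V, mem_nhdsWithin_of_mem_nhds hV, m, hm⟩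

end IsLocallyUniformlyElliptic

lemma HasEllipticForm.exists_bounds_of_isCompact {a b c} (h : HasEllipticForm A e a b c)
    {Q : Set M} (hQ : IsCompact Q) (hQe : Q ⊆ e.source) :
    ∃ B δ : ℝ, 0 < B ∧ 0 < δ ∧ ∀ y ∈ Q,
      ((∀ i j, |a y i j| ≤ B) ∧ (∀ i, |b y i| ≤ B) ∧ |c y| ≤ B) ∧
      ∀ ξ : Fin n → ℝ, δ * (ξ ⬝ᵥ ξ) ≤ ξ ⬝ᵥ (a y *ᵥ ξ) := by
  refine hQ.induction_on (p := fun Q => ∃ B δ : ℝ, 0 < B ∧ 0 < δ ∧ ∀ y ∈ Q,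
      ((∀ i j, |a y i j| ≤ B) ∧ (∀ i, |b y i| ≤ B) ∧ |c y| ≤ B) ∧
      ∀ ξ : Fin n → ℝ, δ * (ξ ⬝ᵥ ξ) ≤ ξ ⬝ᵥ (a y *ᵥ ξ)) ⟨1, 1, by simp⟩
    (fun s t hst ⟨B, δ, hB, hδ, h⟩ => ⟨B, δ, hB, hδ, fun y hy => h y (hst hy)⟩)
    (fun s t ⟨B, δ, hB, hδ, h⟩ ⟨B', δ', hB', hδ', h'⟩ =>
      ⟨max B B', min δ δ', lt_max_of_lt_left hB, lt_min hδ hδ', ?_⟩) fun x hx => ?_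
  · have nn : ∀ ξ : Fin n → ℝ, 0 ≤ ξ ⬝ᵥ ξ := fun ξ =>
      Finset.sum_nonneg fun i _ => mul_self_nonneg _
    rintro y (hy | hy)
    · obtain ⟨⟨h1, h2, h3⟩, h4⟩ := h y hy
      exact ⟨⟨fun i j => (h1 i j).trans (le_max_left _ _), fun i => (h2 i).trans (le_max_left _ _),
        h3.trans (le_max_left _ _)⟩, fun ξ =>
        (mul_le_mul_of_nonneg_right (min_le_left _ _) (nn ξ)).trans (h4 ξ)⟩
    · obtain ⟨⟨h1, h2, h3⟩, h4⟩ := h' y hy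
      exact ⟨⟨fun i j => (h1 i j).trans (le_max_right _ _),
        fun i => (h2 i).trans (le_max_right _ _), h3.trans (le_max_right _ _)⟩, fun ξ =>
        (mul_le_mul_of_nonneg_right (min_le_right _ _) (nn ξ)).trans (h4 ξ)⟩
  · obtain ⟨V, hV, B, hB⟩ := h.locallyBounded x (hQe hx)
    obtain ⟨V', hV', δ, hδ, hE⟩ := h.locallyElliptic x (hQe hx)
    refine ⟨V ∩ V' ∩ e.source, mem_nhdsWithin_of_mem_nhds (Filter.inter_mem (Filter.inter_mem hV hV')
      (e.open_source.mem_nhds (hQe hx))), max B 1, δ, by simp, hδ, fun y hy => ?_⟩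
    obtain ⟨h1, h2, h3⟩ := hB y ⟨hy.1.1, hy.2⟩
    exact ⟨⟨fun i j => (h1 i j).trans (le_max_left _ _), fun i => (h2 i).trans (le_max_left _ _),
      h3.trans (le_max_left _ _)⟩, hE y ⟨hy.1.2, hy.2⟩⟩

end Operator

/-! ### The radial bump and its derivatives. -/

section RadialBump

variable {n : ℕ} {q y : EuclideanSpace ℝ (Fin n)} {R l : ℝ}

lemma partialDeriv_eq_zero_of_mem_closure {u : EuclideanSpace ℝ (Fin n) → ℝ}
    (hu : ContDiff ℝ ∞ u) {O : Set (EuclideanSpace ℝ (Fin n))} (hO : IsOpen O)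
    (h : ∀ z ∈ O, u z = 0) (i : Fin n) : ∀ z ∈ closure O, partialDeriv i u z = 0 := by
  have hc : Continuous (partialDeriv i u) :=
    continuous_iff_continuousAt.2 fun z => (hu.contDiffAt.partialDeriv i).continuousAt
  refine fun z hz => closure_minimal (fun z hz => ?_) (isClosed_eq hc continuous_const) hz
  have h0 : u =ᶠ[𝓝 z] fun _ => 0 := Filter.eventually_of_mem (hO.mem_nhds hz) h
  have := (h0.partialDeriv i).eq_of_nhds
  simpa [partialDeriv] using this

/-- Derivatives of a smooth function are continuous, so they vanish up to the boundary of an open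
set where the function does. This handles the sphere bounding the support of a bump, where the
explicit formula breaks down. -/
lemma secondOrder_eq_zero_of_mem_closure {u : EuclideanSpace ℝ (Fin n) → ℝ}
    (hu : ContDiff ℝ ∞ u) {O : Set (EuclideanSpace ℝ (Fin n))} (hO : IsOpen O)
    (h : ∀ z ∈ O, u z = 0) (hy : y ∈ closure O) (a : Matrix (Fin n) (Fin n) ℝ) (b : Fin n → ℝ)
    (c : ℝ) : secondOrder a b c u y = 0 := by
  have h0 : u y = 0 := closure_minimal h (isClosed_eq hu.continuous continuous_const) hy
  have h1 := fun i => partialDeriv_eq_zero_of_mem_closure hu hO h i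
  have hs : ∀ j, ContDiff ℝ ∞ (partialDeriv j u) := fun j =>
    contDiff_iff_contDiffAt.2 fun z => hu.contDiffAt.partialDeriv j
  have h2 := fun i j => partialDeriv_eq_zero_of_mem_closure (hs j) hO
    (fun z hz => h1 j z (subset_closure hz)) i y hy
  simp [secondOrder, h0, h1 _ y hy, h2]

/-- The smooth function `exp (-l / (R² - |y - q|²))`, extended by zero off the ball of radius `R`
about `q`. -/
noncomputable def radialBump (q : EuclideanSpace ℝ (Fin n)) (R l : ℝ)
    (y : EuclideanSpace ℝ (Fin n)) : ℝ :=
  expNegInvGlue ((R ^ 2 - ‖y - q‖ ^ 2) / l)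

lemma contDiff_radialBump : ContDiff ℝ ∞ (radialBump q R l) :=
  expNegInvGlue.contDiff.comp
    ((contDiff_const.sub ((contDiff_id.sub contDiff_const).norm_sq ℝ)).div_const _)

lemma radialBump_eq_zero (hR : 0 ≤ R) (hl : 0 < l) (hy : R ≤ ‖y - q‖) : radialBump q R l y = 0 :=
  expNegInvGlue.zero_of_nonpos
    (div_nonpos_of_nonpos_of_nonneg (by nlinarith [norm_nonneg (y - q)]) hl.le)

lemma radialBump_eventuallyEq (hl : 0 < l) (hy : ‖y - q‖ < R) :
    radialBump q R l =ᶠ[𝓝 y] fun z => Real.exp (-(l * (R ^ 2 - ‖z - q‖ ^ 2)⁻¹)) := by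
  have hc : ContinuousAt (fun z => ‖z - q‖) y := by fun_prop
  filter_upwards [hc.eventually (gt_mem_nhds hy)] with z hz
  have : 0 < R ^ 2 - ‖z - q‖ ^ 2 := by nlinarith [norm_nonneg (z - q)]
  rw [radialBump, expNegInvGlue, if_neg (not_le.2 (div_pos this hl)), inv_div, div_eq_mul_inv]

lemma hasFDerivAt_sub_norm_sq (R : ℝ) (q y : EuclideanSpace ℝ (Fin n)) :
    HasFDerivAt (fun z => R ^ 2 - ‖z - q‖ ^ 2) (-((2 : ℝ) • innerSL ℝ (y - q))) y := by
  have h := ((hasFDerivAt_id y).sub_const q).norm_sq.const_sub (R ^ 2)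
  refine h.congr_fderiv ?_
  ext v
  simp

lemma hasFDerivAt_inv_sub_norm_sq (hs : R ^ 2 - ‖y - q‖ ^ 2 ≠ 0) :
    HasFDerivAt (fun z => (R ^ 2 - ‖z - q‖ ^ 2)⁻¹)
      ((2 * ((R ^ 2 - ‖y - q‖ ^ 2)⁻¹) ^ 2) • innerSL ℝ (y - q)) y := by
  refine ((hasDerivAt_inv hs).comp_hasFDerivAt y (hasFDerivAt_sub_norm_sq R q y)).congr_fderiv ?_
  ext v
  simp
  ring

lemma innerSL_single_one (z : EuclideanSpace ℝ (Fin n)) (i : Fin n) :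
    innerSL ℝ z (EuclideanSpace.single i 1) = z i := by
  simp [EuclideanSpace.inner_single_right]

lemma partialDeriv_radialBump (hl : 0 < l) (hy : ‖y - q‖ < R) (j : Fin n) :
    partialDeriv j (radialBump q R l) y =
      radialBump q R l y * (l * ((R ^ 2 - ‖y - q‖ ^ 2)⁻¹) ^ 2 * (-2 * (y j - q j))) := by
  have hs : R ^ 2 - ‖y - q‖ ^ 2 ≠ 0 := by nlinarith [norm_nonneg (y - q)]
  have h1 := ((hasFDerivAt_inv_sub_norm_sq hs).const_mul l).neg.exp
  have he := radialBump_eventuallyEq hl hy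
  rw [partialDeriv, (h1.congr_of_eventuallyEq he).fderiv, he.eq_of_nhds]
  simp [innerSL_single_one]
  ring

lemma partialDeriv_partialDeriv_radialBump (hl : 0 < l) (hy : ‖y - q‖ < R) (i j : Fin n) :
    partialDeriv i (partialDeriv j (radialBump q R l)) y =
      radialBump q R l y *
        ((4 * l ^ 2 * ((R ^ 2 - ‖y - q‖ ^ 2)⁻¹) ^ 4 - 8 * l * ((R ^ 2 - ‖y - q‖ ^ 2)⁻¹) ^ 3)
          * ((y i - q i) * (y j - q j))
          - 2 * l * ((R ^ 2 - ‖y - q‖ ^ 2)⁻¹) ^ 2 * (if i = j then 1 else 0)) := by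
  have hs : R ^ 2 - ‖y - q‖ ^ 2 ≠ 0 := by nlinarith [norm_nonneg (y - q)]
  have hc : ContinuousAt (fun z => ‖z - q‖) y := by fun_prop
  have he : partialDeriv j (radialBump q R l) =ᶠ[𝓝 y] fun z => radialBump q R l z *
      (l * ((R ^ 2 - ‖z - q‖ ^ 2)⁻¹) ^ 2 * (-2 * (z j - q j))) := by
    filter_upwards [hc.eventually (gt_mem_nhds hy)] with z hz
    exact partialDeriv_radialBump hl hz j
  have hw : HasFDerivAt (radialBump q R l) (fderiv ℝ (radialBump q R l) y) y :=
    (contDiff_radialBump.differentiable (by simp) y).hasFDerivAt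
  have hp : HasFDerivAt (fun z : EuclideanSpace ℝ (Fin n) => z j)
      (EuclideanSpace.proj j : EuclideanSpace ℝ (Fin n) →L[ℝ] ℝ) y :=
    (EuclideanSpace.proj j : EuclideanSpace ℝ (Fin n) →L[ℝ] ℝ).hasFDerivAt
  have h1 := hw.mul ((((hasFDerivAt_inv_sub_norm_sq hs).pow 2).const_mul l).mul
    ((hp.sub_const (q j)).const_mul (-2)))
  have hd := partialDeriv_radialBump hl hy i
  rw [partialDeriv] at hd
  rw [partialDeriv, (h1.congr_of_eventuallyEq he).fderiv]
  simp [hd, innerSL_single_one, -map_sub]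
  by_cases hij : i = j
  · subst hij
    simp
    field_simp
    ring
  · simp [hij, Ne.symm hij]
    field_simp
    ring

lemma secondOrder_radialBump (hl : 0 < l) (hy : ‖y - q‖ < R) (a : Matrix (Fin n) (Fin n) ℝ)
    (b : Fin n → ℝ) (c : ℝ) :
    secondOrder a b c (radialBump q R l) y = radialBump q R l y *
      ((4 * l ^ 2 * ((R ^ 2 - ‖y - q‖ ^ 2)⁻¹) ^ 4 - 8 * l * ((R ^ 2 - ‖y - q‖ ^ 2)⁻¹) ^ 3)
          * ((fun i => y i - q i) ⬝ᵥ (a *ᵥ fun i => y i - q i))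
        - 2 * l * ((R ^ 2 - ‖y - q‖ ^ 2)⁻¹) ^ 2 * (a.trace + b ⬝ᵥ fun i => y i - q i) + c) := by
  rw [secondOrder]
  simp only [partialDeriv_partialDeriv_radialBump hl hy, partialDeriv_radialBump hl hy]
  generalize radialBump q R l y = w
  generalize (R ^ 2 - ‖y - q‖ ^ 2)⁻¹ = t
  have e1 : ∀ i j, a i j * (w * ((4 * l ^ 2 * t ^ 4 - 8 * l * t ^ 3) * ((y i - q i) * (y j - q j))
      - 2 * l * t ^ 2 * if i = j then 1 else 0)) =
      w * (4 * l ^ 2 * t ^ 4 - 8 * l * t ^ 3) * ((y i - q i) * (a i j * (y j - q j)))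
      - if i = j then w * (2 * l * t ^ 2) * a i j else 0 := fun i j => by
    split_ifs <;> ring
  have e2 : ∀ i, b i * (w * (l * t ^ 2 * (-2 * (y i - q i)))) =
      -(w * (2 * l * t ^ 2)) * (b i * (y i - q i)) := fun i => by ring
  simp only [e1, e2, Finset.sum_sub_distrib, ← Finset.mul_sum, Finset.sum_ite_eq, Finset.mem_univ,
    if_true, Matrix.trace, Matrix.diag, dotProduct, Matrix.mulVec]
  ring

/-- After multiplication by s⁴ the leading term is 4l²Q. The bound l ≥ 4R² absorbs 8lsQ into half of
it, and l·d ≥ C' lets l²d absorb the `t` and `c` terms, leaving at least l²d ≥ d. Dividing by s⁴ ≤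
R⁸ gives κ = d / R⁸. Here `s` stands for R² - |y - q|² and `Q` for the value of the quadratic form.
-/
lemma exists_forall_le_radial_bracket {d C R : ℝ} (hd : 0 < d) (hC : 0 ≤ C) (hR : 0 < R) :
    ∃ l κ : ℝ, 0 < l ∧ 0 < κ ∧ ∀ s Q t c : ℝ, 0 < s → s ≤ R ^ 2 → d ≤ Q → |t| ≤ C → |c| ≤ C →
      κ ≤ (4 * l ^ 2 * s⁻¹ ^ 4 - 8 * l * s⁻¹ ^ 3) * Q - 2 * l * s⁻¹ ^ 2 * t + c := by
  set C' := 2 * R ^ 4 * C + C * R ^ 8 with hC'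
  have hC'0 : 0 ≤ C' := by positivity
  refine ⟨max 1 (max (4 * R ^ 2) (C' / d)), d / R ^ 8, by positivity, by positivity, ?_⟩
  intro s Q t c hs hsR hQ ht hc
  set l := max 1 (max (4 * R ^ 2) (C' / d)) with hl
  have l1 : 1 ≤ l := le_max_left _ _
  have l2 : 4 * R ^ 2 ≤ l := (le_max_left _ _).trans (le_max_right _ _)
  have l3 : C' ≤ l * d := by
    rw [← div_le_iff₀ hd]; exact (le_max_right _ _).trans (le_max_right _ _)
  have hR2 : 0 < R ^ 2 := by positivity
  have s2 : s ^ 2 ≤ R ^ 4 := by nlinarith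
  have s4 : s ^ 4 ≤ R ^ 8 := by nlinarith [sq_nonneg s]
  have key : d ≤ (4 * l ^ 2 - 8 * l * s) * Q - 2 * l * s ^ 2 * t + c * s ^ 4 := by
    have k1 : 2 * l ^ 2 * d ≤ (4 * l ^ 2 - 8 * l * s) * Q := by
      have : 2 * l ^ 2 ≤ 4 * l ^ 2 - 8 * l * s := by nlinarith
      exact mul_le_mul this hQ hd.le (by nlinarith)
    have k2 : s ^ 2 * t ≤ R ^ 4 * C := by
      exact (mul_le_mul_of_nonneg_left ((le_abs_self t).trans ht) (sq_nonneg s)).trans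
        (mul_le_mul_of_nonneg_right s2 hC)
    have k3 : -(C * R ^ 8) ≤ c * s ^ 4 := by
      have h4 : 0 ≤ s ^ 4 := by positivity
      have : -C ≤ c := (abs_le.1 hc).1
      nlinarith
    have k4 : C * R ^ 8 ≤ l * (C * R ^ 8) := le_mul_of_one_le_left (by positivity) l1
    have k5 : l * C' ≤ l * (l * d) := mul_le_mul_of_nonneg_left l3 (by linarith)
    have k6 : d ≤ l * (l * d) := by nlinarith [mul_le_mul l1 l1 zero_le_one (by linarith)]
    have k7 : l * (s ^ 2 * t) ≤ l * (R ^ 4 * C) := mul_le_mul_of_nonneg_left k2 (by linarith)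
    have k8 : l * C' = 2 * (l * (R ^ 4 * C)) + l * (C * R ^ 8) := by rw [hC']; ring
    nlinarith
  have e : (4 * l ^ 2 * s⁻¹ ^ 4 - 8 * l * s⁻¹ ^ 3) * Q - 2 * l * s⁻¹ ^ 2 * t + c =
      ((4 * l ^ 2 - 8 * l * s) * Q - 2 * l * s ^ 2 * t + c * s ^ 4) / s ^ 4 := by
    field_simp
  rw [e]
  exact div_le_div₀ (hd.le.trans key) key (by positivity) s4

end RadialBump

/-! ### Cells: bumps whose failure set can be prescribed. -/

section Cell

variable {n : ℕ} {M : Type*} [TopologicalSpace M]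
    [ChartedSpace (EuclideanSpace ℝ (Fin n)) M]

/-- An open set `U` inside a compact set `T` is a cell for `A` if, for every nonempty open `N ⊆ U`,
some smooth nonnegative function supported in `T` is a subsolution off `N`, with definite lower
bounds on `U`. -/
structure IsCell (A : C^∞⟮𝓡 n, M; ℝ⟯ → M → ℝ) (U T : Set M) : Prop where
  isOpen : IsOpen U
  isCompact : IsCompact T
  subset : U ⊆ T
  exists_bump : ∀ N : Set M, IsOpen N → N.Nonempty → N ⊆ U →
    ∃ (α : C^∞⟮𝓡 n, M; ℝ⟯) (m : ℝ), (∀ x, 0 ≤ α x) ∧ (∀ x ∉ T, α x = 0) ∧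
      (∀ x ∉ N, 0 ≤ A α x) ∧ (∀ x ∈ U, 1 ≤ α x) ∧ (∀ x ∈ U \ N, 1 ≤ A α x) ∧ ∀ x, -m ≤ A α x

variable {A : C^∞⟮𝓡 n, M; ℝ⟯ → M → ℝ}
    {e : OpenPartialHomeomorph M (EuclideanSpace ℝ (Fin n))}

/-- A smooth function on Euclidean space which vanishes off a compact subset of the target of a
chart gives a smooth function on the manifold. -/
lemma exists_contMDiffMap_of_chart [T2Space M] (he : e ∈ IsManifold.maximalAtlas (𝓡 n) ∞ M)
    {g : EuclideanSpace ℝ (Fin n) → ℝ} (hg : ContDiff ℝ ∞ g)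
    {Q : Set (EuclideanSpace ℝ (Fin n))} (hQ : IsCompact Q) (hQe : Q ⊆ e.target)
    (h0 : ∀ y ∉ Q, g y = 0) :
    ∃ f : C^∞⟮𝓡 n, M; ℝ⟯, (∀ x ∈ e.source, f x = g (e x)) ∧
      ∀ x ∉ e.symm '' Q, ∀ᶠ z in 𝓝 x, f z = 0 := by
  have hcl : IsClosed (e.symm '' Q) :=
    (hQ.image_of_continuousOn (e.continuousOn_symm.mono hQe)).isClosed
  set F : M → ℝ := e.source.indicator (g ∘ e) with hF
  have hs : ∀ x ∈ e.source, F x = g (e x) := fun x hx => Set.indicator_of_mem hx _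
  have hz : ∀ x ∉ e.symm '' Q, F x = 0 := fun x hx => by
    by_cases hxs : x ∈ e.source
    · rw [hs x hxs]
      exact h0 _ fun h => hx ⟨_, h, e.left_inv hxs⟩
    · exact Set.indicator_of_notMem hxs _
  have hz' : ∀ x ∉ e.symm '' Q, ∀ᶠ z in 𝓝 x, F z = 0 := fun x hx =>
    Filter.eventually_of_mem (hcl.isOpen_compl.mem_nhds hx) hz
  have hsm : ContMDiff (𝓡 n) 𝓘(ℝ) ∞ F := by
    intro x
    by_cases hx : x ∈ e.symm '' Q
    · have hxs : x ∈ e.source := by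
        obtain ⟨y, hy, rfl⟩ := hx
        exact e.map_target (hQe hy)
      have h1 : ContMDiffOn (𝓡 n) 𝓘(ℝ) ∞ (g ∘ e) e.source :=
        hg.contMDiff.comp_contMDiffOn (contMDiffOn_of_mem_maximalAtlas he)
      refine (h1.contMDiffAt (e.open_source.mem_nhds hxs)).congr_of_eventuallyEq ?_
      exact Filter.eventually_of_mem (e.open_source.mem_nhds hxs) hs
    · exact (contMDiffAt_const (c := (0 : ℝ))).congr_of_eventuallyEq (hz' x hx)
  exact ⟨⟨F, hsm⟩, hs, hz'⟩

lemma abs_coord_le_norm (z : EuclideanSpace ℝ (Fin n)) (i : Fin n) : |z i| ≤ ‖z‖ := by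
  simpa using PiLp.norm_apply_le z i

lemma dotProduct_self_eq_norm_sq (z : EuclideanSpace ℝ (Fin n)) :
    (fun i => z i) ⬝ᵥ (fun i => z i) = ‖z‖ ^ 2 := by
  rw [EuclideanSpace.real_norm_sq_eq]
  simp [dotProduct, sq]

/-- For large `l` the radial bump in a chart is a subsolution off any given neighbourhood of its
centre. -/
lemma exists_radialBump_subsolution {a b c} (hf : HasEllipticForm A e a b c)
    {q : EuclideanSpace ℝ (Fin n)} {R ε : ℝ} (hR : 0 < R) (hε : 0 < ε)
    (hball : Metric.closedBall q R ⊆ e.target) :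
    ∃ l κ : ℝ, 0 < l ∧ 0 < κ ∧ ∀ x ∈ e.source, ε ≤ ‖e x - q‖ → ‖e x - q‖ < R →
      κ * radialBump q R l (e x) ≤
        secondOrder (a x) (b x) (c x) (radialBump q R l) (e x) := by
  have hT : IsCompact (e.symm '' Metric.closedBall q R) :=
    (isCompact_closedBall q R).image_of_continuousOn (e.continuousOn_symm.mono hball)
  obtain ⟨B, δ, hB, hδ, hbd⟩ := hf.exists_bounds_of_isCompact hT (by
    rintro _ ⟨y, hy, rfl⟩; exact e.map_target (hball hy))
  obtain ⟨l, κ, hl, hκ, hlk⟩ := exists_forall_le_radial_bracket (d := δ * ε ^ 2)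
    (C := n * B + n * (B * R) + B) (R := R) (by positivity) (by positivity) hR
  refine ⟨l, κ, hl, hκ, fun x hx hx1 hx2 => ?_⟩
  have hxT : x ∈ e.symm '' Metric.closedBall q R :=
    ⟨e x, by simpa [dist_eq_norm] using hx2.le, e.left_inv hx⟩
  obtain ⟨⟨ba, bb, bc⟩, hell⟩ := hbd x hxT
  rw [secondOrder_radialBump hl hx2, mul_comm κ]
  refine mul_le_mul_of_nonneg_left ?_ (expNegInvGlue.nonneg _)
  have hz : ∀ i, e x i - q i = (e x - q) i := fun i => by simp
  have hnn := norm_nonneg (e x - q)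
  simp only [hz]
  refine hlk _ _ _ _ (by nlinarith) (by nlinarith) ?_ ?_ ?_
  · refine le_trans ?_ (hell _)
    rw [dotProduct_self_eq_norm_sq]
    gcongr
  · refine (abs_add_le _ _).trans ?_
    have h1 : |(a x).trace| ≤ n * B := (Finset.abs_sum_le_sum_abs _ _).trans
      ((Finset.sum_le_sum (g := fun _ => B) fun i _ => ba i i).trans (by simp))
    have h2 : |b x ⬝ᵥ fun i => (e x - q) i| ≤ n * (B * R) := (Finset.abs_sum_le_sum_abs _ _).trans
      ((Finset.sum_le_sum (g := fun _ => B * R) fun i _ => by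
        rw [abs_mul]
        exact mul_le_mul (bb i) ((abs_coord_le_norm _ i).trans hx2.le) (abs_nonneg _) hB.le).trans
        (by simp))
    linarith
  · have : 0 ≤ n * B + n * (B * R) := by positivity
    linarith

lemma IsLocallyUniformlyElliptic.exists_isCell [T2Space M] [IsManifold (𝓡 n) ∞ M]
    (hA : IsLocallyUniformlyElliptic A) {p : M} {W : Set M} (hW : W ∈ 𝓝 p) : ∃ U T, IsCell A U T ∧ p ∈ U ∧ T ⊆ W := by
  obtain ⟨e, he, hp, a, b, c, hf⟩ := hA p
  have hnhds : e.target ∩ e.symm ⁻¹' W ∈ 𝓝 (e p) := by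
    refine Filter.inter_mem (e.open_target.mem_nhds (e.map_source hp)) ?_
    refine (e.continuousAt_symm (e.map_source hp)) ?_
    rwa [e.left_inv hp]
  obtain ⟨r', hr', hball'⟩ := Metric.nhds_basis_closedBall.mem_iff.1 hnhds
  -- For any centre `q` in the ball of radius `r` about `e p`, the ball of radius 2r about `q`
  -- contains that ball and stays inside the one of radius 3r. So one pair `U`, `T` serves every
  -- `N`.
  obtain ⟨r, hr, rfl⟩ : ∃ r, 0 < r ∧ r' = 3 * r := ⟨r' / 3, by positivity, by ring⟩
  have hball : Metric.closedBall (e p) (3 * r) ⊆ e.target := fun y hy => (hball' hy).1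
  have hTc : IsCompact (e.symm '' Metric.closedBall (e p) (3 * r)) :=
    (isCompact_closedBall _ _).image_of_continuousOn (e.continuousOn_symm.mono hball)
  refine ⟨e.source ∩ e ⁻¹' Metric.ball (e p) r, e.symm '' Metric.closedBall (e p) (3 * r),
    ⟨e.isOpen_inter_preimage Metric.isOpen_ball, hTc, ?_, ?_⟩, ⟨hp, by simpa using hr⟩, ?_⟩
  · rintro x ⟨hx, hx'⟩
    refine ⟨e x, Metric.closedBall_subset_closedBall (by linarith)
      (Metric.ball_subset_closedBall hx'), e.left_inv hx⟩
  · rintro N hN ⟨q₀, hq₀⟩ hNU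
    have hq₀s : q₀ ∈ e.source := (hNU hq₀).1
    set q := e q₀ with hq
    have hqr : dist q (e p) < r := (hNU hq₀).2
    have hsub : Metric.closedBall q (2 * r) ⊆ Metric.closedBall (e p) (3 * r) :=
      Metric.closedBall_subset_closedBall' (by linarith)
    obtain ⟨ε, hε, hεN⟩ := Metric.nhds_basis_ball.mem_iff.1
      (show e.target ∩ e.symm ⁻¹' N ∈ 𝓝 q by
        refine Filter.inter_mem (e.open_target.mem_nhds (e.map_source hq₀s)) ?_
        refine (e.continuousAt_symm (e.map_source hq₀s)) ?_
        rw [e.left_inv hq₀s]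
        exact hN.mem_nhds hq₀)
    have hout : ∀ x ∈ e.source, x ∉ N → ε ≤ ‖e x - q‖ := fun x hx hxN => by
      by_contra! h
      refine hxN ?_
      have := (hεN (show e x ∈ Metric.ball q ε by simpa [dist_eq_norm] using h)).2
      rwa [Set.mem_preimage, e.left_inv hx] at this
    obtain ⟨l, κ, hl, hκ, hlk⟩ := exists_radialBump_subsolution hf (q := q) (R := 2 * r)
      (by positivity) hε (hsub.trans hball)
    obtain ⟨α, hα, hα0⟩ := exists_contMDiffMap_of_chart he
      (contDiff_radialBump (q := q) (R := 2 * r) (l := l))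
      (isCompact_closedBall q (2 * r)) (hsub.trans hball) (fun y hy => by
        refine radialBump_eq_zero (by positivity) hl ?_
        simpa [dist_eq_norm] using (not_le.1 hy).le)
    have hαnn : ∀ x, 0 ≤ α x := fun x => by
      by_cases hx : x ∈ e.source
      · rw [hα x hx]; exact expNegInvGlue.nonneg _
      · refine (hα0 x ?_).self_of_nhds.ge
        rintro ⟨y, hy, rfl⟩
        exact hx (e.map_target (hball (hsub hy)))
    have hAα : ∀ x ∈ e.source,
        A α x = secondOrder (a x) (b x) (c x) (radialBump q (2 * r) l) (e x) := fun x hx => by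
      rw [hf.apply_eq_secondOrder α hx]
      refine secondOrder_congr _ _ _ ?_
      filter_upwards [e.open_target.mem_nhds (e.map_source hx)] with y hy
      rw [Function.comp_apply, hα _ (e.map_target hy), e.right_inv hy]
    have hAin : ∀ x ∈ e.source, x ∉ N → ‖e x - q‖ < 2 * r → κ * α x ≤ A α x :=
      fun x hx hxN hxr => by
        rw [hAα x hx, hα x hx]
        exact hlk x hx (hout x hx hxN) hxr
    have hAnn : ∀ x ∉ N, 0 ≤ A α x := fun x hxN => by
      by_cases hx : x ∈ e.symm '' Metric.closedBall q (2 * r)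
      · have hxs : x ∈ e.source := by
          obtain ⟨y, hy, rfl⟩ := hx
          exact e.map_target (hball (hsub hy))
        rcases lt_or_ge ‖e x - q‖ (2 * r) with h | h
        · exact (mul_nonneg hκ.le (hαnn x)).trans (hAin x hxs hxN h)
        · rw [hAα x hxs]
          refine (secondOrder_eq_zero_of_mem_closure contDiff_radialBump
            (O := (Metric.closedBall q (2 * r))ᶜ) Metric.isClosed_closedBall.isOpen_compl
            (fun z hz => radialBump_eq_zero (by positivity) hl ?_) ?_ _ _ _).ge
          · simpa [dist_eq_norm] using (not_le.1 (show ¬ dist z q ≤ 2 * r from hz)).le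
          · rw [closure_compl, interior_closedBall _ (by positivity)]
            simpa [dist_eq_norm] using h
      · exact (hA.eq_zero_of_eventuallyEq (hα0 x hx)).ge
    -- A lower bound for the bump on `U`, where |e x - q| ≤ r + |q - e p| < 2r.
    set η := expNegInvGlue (((2 * r) ^ 2 - (r + dist q (e p)) ^ 2) / l) with hη
    have hηpos : 0 < η := expNegInvGlue.pos_of_pos
      (div_pos (by nlinarith [dist_nonneg (x := q) (y := e p)]) hl)
    have hU : ∀ x ∈ e.source ∩ e ⁻¹' Metric.ball (e p) r, ‖e x - q‖ < 2 * r ∧ η ≤ α x := by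
      rintro x ⟨hxs, hxb⟩
      have hd : ‖e x - q‖ ≤ r + dist q (e p) := by
        rw [← dist_eq_norm, dist_comm q]
        exact (dist_triangle _ (e p) _).trans
          (by simpa using (show dist (e x) (e p) < r from hxb).le)
      refine ⟨by linarith, ?_⟩
      rw [hα x hxs]
      refine expNegInvGlue.monotone ?_
      gcongr
    set k := max (1 / η) (1 / (κ * η)) with hk
    have hkpos : 0 < k := lt_max_of_lt_left (by positivity)
    obtain ⟨m, hm⟩ := hA.exists_abs_le_of_isCompact (k • α) hTc
    have hsub' := Set.image_mono (f := e.symm) hsub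
    refine ⟨k • α, max m 0, fun x => mul_nonneg hkpos.le (hαnn x), fun x hx => ?_, fun x hx => ?_,
      fun x hx => ?_, fun x hx => ?_, fun x => ?_⟩
    · have := (hα0 x fun h => hx (hsub' h)).self_of_nhds
      simp [this]
    · rw [hA.map_smul]
      exact mul_nonneg hkpos.le (hAnn x hx)
    · calc (1 : ℝ) = 1 / η * η := by field_simp
        _ ≤ k * α x := mul_le_mul (le_max_left _ _) (hU x hx).2 hηpos.le hkpos.le
    · rw [hA.map_smul]
      calc (1 : ℝ) = 1 / (κ * η) * (κ * η) := by field_simp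
        _ ≤ k * (κ * α x) := mul_le_mul (le_max_right _ _)
          (mul_le_mul_of_nonneg_left (hU x hx.1).2 hκ.le) (by positivity) hkpos.le
        _ ≤ k * A α x := mul_le_mul_of_nonneg_left
          (hAin x hx.1.1 hx.2 (hU x hx.1).1) hkpos.le
    · by_cases hx : x ∈ e.symm '' Metric.closedBall (e p) (3 * r)
      · exact (neg_le_neg (le_max_left _ _)).trans (abs_le.1 (hm x hx)).1
      · rw [hA.map_smul, hA.eq_zero_of_eventuallyEq (hα0 x fun h => hx (hsub' h))]
        simp
  · rintro _ ⟨y, hy, rfl⟩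
    exact (hball' hy).2

end Cell

/-! ### Rays in locally finite graphs. -/

section Rays

variable {V : Type*} {G : V → V → Prop}

/-- `ReachAvoiding G F v w` means that `w` can be reached from `v` along the relation `G`, with
every vertex after `v` outside `F`. -/
def ReachAvoiding (G : V → V → Prop) (F : Set V) : V → V → Prop :=
  Relation.ReflTransGen fun a b => G a b ∧ b ∉ F

lemma ReachAvoiding.notMem {F : Set V} {v w : V} (h : ReachAvoiding G F v w) (hv : v ∉ F) :
    w ∉ F := by
  induction h with
  | refl => exact hv
  | tail _ h _ => exact h.2

lemma ReachAvoiding.symm (hG : ∀ ⦃v w⦄, G v w → G w v) {F : Set V} {v w : V} (h : ReachAvoiding G F v w)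
    (hv : v ∉ F) : ReachAvoiding G F w v := by
  induction h with
  | refl => exact .refl
  | tail h1 h2 ih => exact .head ⟨hG h2.1, ReachAvoiding.notMem h1 hv⟩ ih

/-- Cut the path at its last visit to `v`: the remainder starts at a neighbour and never returns. -/
lemma ReachAvoiding.eq_or_exists_adj {F : Set V} {v w : V} (h : ReachAvoiding G F v w) :
    w = v ∨ ∃ u, G v u ∧ u ∉ insert v F ∧ ReachAvoiding G (insert v F) u w := by
  induction h with
  | refl => exact .inl rfl
  | @tail b c _ h2 ih =>
    by_cases hc : c = v
    · exact .inl hc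
    have hcF : c ∉ insert v F := by simp [hc, h2.2]
    rcases ih with rfl | ⟨u, hu, huF, hr⟩
    · exact .inr ⟨c, h2.1, hcF, .refl⟩
    · exact .inr ⟨u, hu, huF, hr.tail ⟨h2.1, hcF⟩⟩

/-- Removing `v`, some neighbour of `v` still reaches infinitely many vertices. -/
lemma exists_adj_infinite_reachAvoiding (hfin : ∀ v, {w | G v w}.Finite) {F : Set V} {v : V}
    (h : {w | ReachAvoiding G F v w}.Infinite) :
    ∃ u, G v u ∧ u ∉ insert v F ∧ {w | ReachAvoiding G (insert v F) u w}.Infinite := by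
  by_contra! hcon
  refine h (((Set.finite_singleton v).union (((hfin v).subset
    (fun u hu => hu.1 : {u | G v u ∧ u ∉ insert v F} ⊆ _)).biUnion
      fun u hu => hcon u hu.1 hu.2)).subset fun w hw => ?_)
  rcases ReachAvoiding.eq_or_exists_adj hw with rfl | ⟨u, hu, huF, hr⟩
  · exact .inl rfl
  · exact .inr (Set.mem_biUnion (show u ∈ {u | G v u ∧ u ∉ insert v F} from ⟨hu, huF⟩) hr)

/-- König's lemma: a ray without repetitions starting at `v` and avoiding `F`. -/
lemma exists_ray_avoiding (hfin : ∀ v, {w | G v w}.Finite) {F : Set V} {v : V} (hv : v ∉ F)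
    (h : {w | ReachAvoiding G F v w}.Infinite) :
    ∃ P : ℕ → V, P 0 = v ∧ (∀ k, G (P k) (P (k + 1))) ∧ Function.Injective P ∧ ∀ k, P k ∉ F := by
  -- A state is the set of forbidden vertices together with the current vertex. Each step forbids
  -- the vertex it leaves, which makes the ray injective.
  let S := {s : Set V × V // s.2 ∉ s.1 ∧ {w | ReachAvoiding G s.1 s.2 w}.Infinite}
  have step : ∀ s : S, ∃ t : S, t.1.1 = insert s.1.2 s.1.1 ∧ G s.1.2 t.1.2 := fun s => by
    obtain ⟨u, h1, h2, h3⟩ := exists_adj_infinite_reachAvoiding hfin s.2.2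
    exact ⟨⟨(_, u), h2, h3⟩, rfl, h1⟩
  choose nxt hn1 hn2 using step
  let s : ℕ → S := fun k => nxt^[k] ⟨(F, v), hv, h⟩
  have hs : ∀ k, s (k + 1) = nxt (s k) := fun k => Function.iterate_succ_apply' _ _ _
  have hmono : Monotone fun k => (s k).1.1 := monotone_nat_of_le_succ fun k => by
    rw [hs, hn1]; exact Set.subset_insert _ _
  have hlt : ∀ i j, i < j → (s i).1.2 ∈ (s j).1.1 := fun i j hij => by
    refine hmono (show i + 1 ≤ j from hij) ?_
    simp only [hs, hn1]
    exact Set.mem_insert _ _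
  refine ⟨fun k => (s k).1.2, rfl, fun k => ?_, fun i j hij => ?_, fun k hk => ?_⟩
  · simp only [hs]; exact hn2 _
  · have hij' : (s i).1.2 = (s j).1.2 := hij
    rcases lt_trichotomy i j with hlt' | rfl | hlt'
    · exact absurd (hij' ▸ hlt i j hlt') (s j).2.1
    · rfl
    · exact absurd (hij' ▸ hlt j i hlt') (s i).2.1
  · exact (s k).2.1 (hmono (Nat.zero_le k) hk)

/-- In a locally finite graph with infinite components, only finitely many vertices are enclosed by
a given finite set. -/
lemma finite_setOf_finite_reachAvoiding (hG : ∀ ⦃v w⦄, G v w → G w v) (hfin : ∀ v, {w | G v w}.Finite)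
    (hinf : ∀ v, {w | ReachAvoiding G ∅ v w}.Infinite) {F : Set V} (hF : F.Finite) :
    {v | v ∉ F ∧ {w | ReachAvoiding G F v w}.Finite}.Finite := by
  have hN : {u | (∃ f ∈ F, G f u) ∧ {w | ReachAvoiding G F u w}.Finite}.Finite :=
    (hF.biUnion fun f _ => hfin f).subset fun u hu => by
      obtain ⟨⟨f, hf, hfu⟩, -⟩ := hu
      exact Set.mem_biUnion hf hfu
  refine (hN.biUnion fun u hu => hu.2).subset fun v ⟨hvF, hv⟩ => ?_
  obtain ⟨w, hw, hwn⟩ := ((hinf v).sdiff hv).nonempty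
  -- A path from an enclosed `v` to a vertex it cannot reach must hit `F`. The vertex `u` just
  -- before the first hit borders `F` and is itself enclosed; there are finitely many such `u`, and
  -- `v` is among the finitely many vertices reachable from one of them.
  have key : ReachAvoiding G F v w ∨ ∃ u, ReachAvoiding G F v u ∧ ∃ f ∈ F, G f u := by
    clear hwn
    induction hw with
    | refl => exact .inl .refl
    | @tail b c _ h2 ih =>
      rcases ih with h | h
      · by_cases hc : c ∈ F
        · exact .inr ⟨b, h, c, hc, hG h2.1⟩
        · exact .inl (h.tail ⟨h2.1, hc⟩)
      · exact .inr h
  obtain h | ⟨u, hu, hf⟩ := key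
  · exact absurd h hwn
  · refine Set.mem_biUnion (show u ∈ {u | _ ∧ _} from ⟨hf, hv.subset fun z hz => ?_⟩)
      (hu.symm hG hvF)
    exact Relation.ReflTransGen.trans hu hz

/-- A countable locally finite graph whose components are infinite carries a locally finite family
of rays, one starting at each vertex. -/
lemma exists_locallyFinite_rays [Countable V] (hG : ∀ ⦃v w⦄, G v w → G w v) (hfin : ∀ v, {w | G v w}.Finite)
    (hinf : ∀ v, {w | ReachAvoiding G ∅ v w}.Infinite) :
    ∃ P : V → ℕ → V, (∀ v, P v 0 = v) ∧ (∀ v k, G (P v k) (P v (k + 1))) ∧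
      (∀ v, Function.Injective (P v)) ∧ ∀ w, {v | ∃ k, P v k = w}.Finite := by
  classical
  obtain ⟨ν, hν⟩ := exists_injective_nat V
  let F : ℕ → Set V := fun k => {w | ν w < k}
  have hF : ∀ k, (F k).Finite := fun k => (Set.finite_Iio k).preimage hν.injOn
  let good : V → ℕ → Prop := fun v k => v ∉ F k ∧ {w | ReachAvoiding G (F k) v w}.Infinite
  have good0 : ∀ v, good v 0 := fun v => by
    have : F 0 = ∅ := by simp [F]
    exact ⟨by simp [this], by rw [this]; exact hinf v⟩
  -- The ray from `v` avoids the longest initial segment of the enumeration, up to the label of `v`,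
  -- that leaves infinitely many vertices within reach. If it meets `w`, then `v` lies in `F (ν w +
  -- 1)` or is enclosed by it, and this allows only finitely many `v`.
  let f : V → ℕ := fun v => Nat.findGreatest (good v) (ν v)
  have hf : ∀ v, good v (f v) := fun v => Nat.findGreatest_spec (Nat.zero_le _) (good0 v)
  choose P h0 hadj hinj hav using fun v => exists_ray_avoiding hfin (hf v).1 (hf v).2
  refine ⟨P, h0, hadj, hinj, fun w => ?_⟩
  refine ((hF (ν w + 1)).union
    (finite_setOf_finite_reachAvoiding hG hfin hinf (hF (ν w + 1)))).subset ?_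
  rintro v ⟨k, rfl⟩
  by_contra hcon
  simp only [Set.mem_union, not_or, Set.mem_ofPred_eq, not_and] at hcon
  have hg : good v (ν (P v k) + 1) := ⟨hcon.1, hcon.2 hcon.1⟩
  have hle : ν (P v k) + 1 ≤ f v := Nat.le_findGreatest (by simpa [F] using hcon.1) hg
  exact hav v k (show ν (P v k) < f v from hle)

end Rays

/-! ### Disjoint refinement of locally finite open sequences; closed components. -/

section Topology

/-- A locally finite sequence of nonempty open sets in a metrizable space without isolated points
can be shrunk to a disjoint sequence of nonempty open sets. -/
lemma exists_pairwise_disjoint_isOpen_subset {X : Type*} [TopologicalSpace X]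
    [TopologicalSpace.MetrizableSpace X] [∀ x : X, (𝓝[≠] x).NeBot] {O : ℕ → Set X}
    (hO : ∀ k, IsOpen (O k)) (hne : ∀ k, (O k).Nonempty) (hfin : LocallyFinite O) :
    ∃ N : ℕ → Set X, (∀ k, IsOpen (N k)) ∧ (∀ k, (N k).Nonempty) ∧ (∀ k, N k ⊆ O k) ∧
      Pairwise fun i j => Disjoint (N i) (N j) := by
  classical
  let := TopologicalSpace.metrizableSpaceMetric X
  have hpick : ∀ k (F : Finset X), ∃ x, x ∈ O k ∧ x ∉ F := fun k F => by
    obtain ⟨x, hx⟩ := hne k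
    obtain ⟨y, hy⟩ := ((infinite_of_mem_nhds x ((hO k).mem_nhds hx)).sdiff
      F.finite_toSet).nonempty
    exact ⟨y, hy.1, hy.2⟩
  choose pick hp1 hp2 using hpick
  let F : ℕ → Finset X := fun k => Nat.rec ∅ (fun k F => insert (pick k F) F) k
  let q : ℕ → X := fun k => pick k (F k)
  have hFs : ∀ k, F (k + 1) = insert (q k) (F k) := fun k => rfl
  have hFm : Monotone F := monotone_nat_of_le_succ fun k => by
    rw [hFs]; exact Finset.subset_insert _ _
  have hlt : ∀ i j, i < j → q i ≠ q j := fun i j hij h => by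
    refine hp2 j (F j) (hFm (show i + 1 ≤ j from hij) ?_)
    rw [hFs]
    exact Finset.mem_insert.2 (.inl h.symm)
  have hinj : ∀ i j, i ≠ j → q i ≠ q j := fun i j hij => by
    rcases hij.lt_or_gt with h | h
    · exact hlt i j h
    · exact (hlt j i h).symm
  -- Only finitely many `O j` come near `q k`, so the distinct points `q j` do not accumulate there.
  -- Balls of half these radii are then disjoint.
  have hε : ∀ k, ∃ ε > 0, ∀ j, j ≠ k → ε ≤ dist (q j) (q k) := fun k => by
    obtain ⟨V, hV, hVf⟩ := hfin (q k)
    have hnear : ∀ᶠ x in 𝓝 (q k), ∀ j ∈ {j | (O j ∩ V).Nonempty}, j ≠ k → x ≠ q j :=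
      (Filter.eventually_all_finite hVf).2 fun j _ => by
        by_cases hjk : j = k
        · simp [hjk]
        · filter_upwards [isOpen_ne.mem_nhds (hinj k j (Ne.symm hjk))] with x hx _ using hx
    obtain ⟨ε, hε, hb⟩ := Metric.nhds_basis_ball.mem_iff.1 (Filter.inter_mem hV hnear)
    refine ⟨ε, hε, fun j hjk => ?_⟩
    by_contra! hlt
    have hj := hb (show q j ∈ Metric.ball (q k) ε from hlt)
    exact hj.2 j ⟨q j, hp1 j _, hj.1⟩ hjk rfl
  choose ε hε0 hε1 using hε
  refine ⟨fun k => O k ∩ Metric.ball (q k) (ε k / 2), fun k => (hO k).inter Metric.isOpen_ball,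
    fun k => ⟨q k, hp1 k _, by simpa using hε0 k⟩, fun k => Set.inter_subset_left, ?_⟩
  intro i j hij
  refine Set.disjoint_left.2 fun z hi hj => ?_
  have h1 : dist z (q i) < ε i / 2 := hi.2
  have h2 : dist z (q j) < ε j / 2 := hj.2
  have h3 := hε1 i j hij.symm
  have h4 := hε1 j i hij
  have h5 := dist_triangle_left (q i) (q j) z
  rw [dist_comm] at h3
  linarith

lemma IsClosed.connectedComponentIn {X : Type*} [TopologicalSpace X] {D : Set X} (hD : IsClosed D)
    (x : X) : IsClosed (connectedComponentIn D x) := by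
  by_cases hx : x ∈ D
  · refine isClosed_of_closure_subset ?_
    exact isPreconnected_connectedComponentIn.closure.subset_connectedComponentIn
      (subset_closure (mem_connectedComponentIn hx))
      (closure_minimal (connectedComponentIn_subset D x) hD)
  · rw [connectedComponentIn_eq_empty hx]
    exact isClosed_empty

end Topology

/-! ### Locally finite sums and chains of cells. -/

section LocallyFiniteSum

variable {n : ℕ} {M : Type*} [TopologicalSpace M]
    [ChartedSpace (EuclideanSpace ℝ (Fin n)) M] [IsManifold (𝓡 n) ∞ M]
    {A : C^∞⟮𝓡 n, M; ℝ⟯ → M → ℝ}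

lemma sum_contMDiffMap_apply {n : ℕ} {M : Type*} [TopologicalSpace M]
    [ChartedSpace (EuclideanSpace ℝ (Fin n)) M] {ι : Type*} (s : Finset ι)
    (f : ι → C^∞⟮𝓡 n, M; ℝ⟯) (x : M) : (∑ i ∈ s, f i) x = ∑ i ∈ s, f i x := by
  classical
  induction s using Finset.induction_on with
  | empty => rfl
  | insert i s hi ih => rw [Finset.sum_insert hi, Finset.sum_insert hi, ← ih]; rfl

lemma IsLocallyUniformlyElliptic.exists_hasSum_of_locallyFinite
    (hA : IsLocallyUniformlyElliptic A) {ι : Type*} (f : ι → C^∞⟮𝓡 n, M; ℝ⟯) {T : ι → Set M}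
    (hT : LocallyFinite T) (h0 : ∀ i, ∀ x ∉ T i, f i x = 0) :
    ∃ φ : C^∞⟮𝓡 n, M; ℝ⟯, ∀ x, HasSum (fun i => f i x) (φ x) ∧
      HasSum (fun i => A (f i) x) (A φ x) := by
  have hsupp : ∀ i, Function.support (f i) ⊆ T i := fun i x hx => by
    by_contra h
    exact hx (h0 i x h)
  let φ : C^∞⟮𝓡 n, M; ℝ⟯ := ⟨fun x => ∑ᶠ i, f i x,
    contMDiff_finsum (fun i => (f i).contMDiff) (hT.subset hsupp)⟩
  refine ⟨φ, fun x => ?_⟩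
  obtain ⟨V, hV, hVf⟩ := hT x
  have hz : ∀ i ∉ hVf.toFinset, ∀ y ∈ V, f i y = 0 := fun i hi y hy => h0 i y fun hyT =>
    hi (hVf.mem_toFinset.2 ⟨y, hyT, hy⟩)
  have hφ : ∀ y ∈ V, φ y = ∑ i ∈ hVf.toFinset, f i y := fun y hy =>
    finsum_eq_sum_of_support_subset _ fun i hi => by
      by_contra h
      exact hi (hz i h y hy)
  constructor
  · rw [hφ x (mem_of_mem_nhds hV)]
    exact hasSum_sum_of_ne_finset_zero fun i hi => hz i hi x (mem_of_mem_nhds hV)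
  · have : A φ x = ∑ i ∈ hVf.toFinset, A (f i) x := by
      rw [← hA.map_sum]
      refine hA.congr_of_eventuallyEq (Filter.eventually_of_mem hV fun y hy => ?_)
      rw [hφ y hy]
      exact (sum_contMDiffMap_apply _ f y).symm
    rw [this]
    exact hasSum_sum_of_ne_finset_zero fun i hi =>
      hA.eq_zero_of_eventuallyEq (Filter.eventually_of_mem hV (hz i hi))

/-- Along a locally finite chain of cells, the set where subsolution fails can be pushed to
infinity. -/
lemma IsLocallyUniformlyElliptic.exists_subsolution_of_chain [TopologicalSpace.MetrizableSpace M]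
    [∀ x : M, (𝓝[≠] x).NeBot] (hA : IsLocallyUniformlyElliptic A) {U T : ℕ → Set M}
    (hcell : ∀ k, IsCell A (U k) (T k)) (hT : LocallyFinite T)
    (hUU : ∀ k, (U k ∩ U (k + 1)).Nonempty) :
    ∃ φ : C^∞⟮𝓡 n, M; ℝ⟯, (∀ x, 0 ≤ φ x) ∧ (∀ x, 0 ≤ A φ x) ∧ (∀ x ∉ ⋃ k, T k, φ x = 0) ∧
      ∀ x ∈ U 0, 1 ≤ φ x ∧ 1 ≤ A φ x := by
  obtain ⟨N, hNo, hNne, hNsub, hNd⟩ := exists_pairwise_disjoint_isOpen_subset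
    (fun k => (hcell k).isOpen.inter (hcell (k + 1)).isOpen) hUU
    (hT.subset fun k => Set.inter_subset_left.trans (hcell k).subset)
  choose α m hα0 hαT hαN hαU hAU hAm using fun k =>
    (hcell k).exists_bump (N k) (hNo k) (hNne k) ((hNsub k).trans Set.inter_subset_left)
  -- On `N k` the `k`-th term is at least -|m k| · c k, so this recursion makes the two terms `k`
  -- and `k + 1` add up to at least 1 there.
  let c : ℕ → ℝ := fun k => Nat.rec 1 (fun k ck => |m k| * ck + 1) k
  have hcs : ∀ k, c (k + 1) = |m k| * c k + 1 := fun k => rfl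
  have hc1 : ∀ k, 1 ≤ c k := fun k => by
    induction k with
    | zero => exact le_rfl
    | succ k ih => rw [hcs]; nlinarith [abs_nonneg (m k)]
  have hc0 : ∀ k, 0 ≤ c k := fun k => zero_le_one.trans (hc1 k)
  obtain ⟨φ, hφ⟩ := hA.exists_hasSum_of_locallyFinite (fun k => c k • α k) hT (fun k x hx => by
    simp [hαT k x hx])
  have hφ1 : ∀ x, HasSum (fun k => c k * α k x) (φ x) := fun x => (hφ x).1
  have hφ2 : ∀ x, HasSum (fun k => c k * A (α k) x) (A φ x) := fun x => by
    simpa only [hA.map_smul] using (hφ x).2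
  have hout : ∀ x, (∀ k, x ∉ N k) → ∀ k, 0 ≤ c k * A (α k) x := fun x hx k =>
    mul_nonneg (hc0 k) (hαN k x (hx k))
  -- By disjointness only the `k`-th term can be negative on `N k`, and `N k` lies in `U (k + 1)`
  -- outside `N (k + 1)`, where the next bump is a strict subsolution.
  have hin : ∀ k, ∀ x ∈ N k, 1 ≤ A φ x := fun k x hx => by
    have hother : ∀ j, j ≠ k → x ∉ N j := fun j hj hxj =>
      Set.disjoint_left.1 (hNd hj) hxj hx
    have hnext : 1 ≤ A (α (k + 1)) x :=
      hAU (k + 1) x ⟨((hNsub k) hx).2, hother (k + 1) (by simp)⟩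
    have hle := sum_le_hasSum {k, k + 1} (fun j hj => by
      have : j ≠ k := fun h => hj (by simp [h])
      exact mul_nonneg (hc0 j) (hαN j x (hother j this))) (hφ2 x)
    rw [Finset.sum_pair (by simp), hcs] at hle
    have h1 : -(|m k| * c k) ≤ c k * A (α k) x := by
      have : -|m k| ≤ A (α k) x := (neg_le_neg (le_abs_self _)).trans (hAm k x)
      nlinarith [hc0 k]
    have h2 : |m k| * c k + 1 ≤ (|m k| * c k + 1) * A (α (k + 1)) x :=
      le_mul_of_one_le_right (by have := hc0 k; positivity) hnext
    linarith
  refine ⟨φ, fun x => HasSum.nonneg (fun k => mul_nonneg (hc0 k) (hα0 k x)) (hφ1 x), fun x => ?_,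
    fun x hx => ?_, fun x hx => ⟨?_, ?_⟩⟩
  · by_cases h : ∃ k, x ∈ N k
    · obtain ⟨k, hk⟩ := h
      exact zero_le_one.trans (hin k x hk)
    · push Not at h
      exact HasSum.nonneg (hout x h) (hφ2 x)
  · refine (hφ1 x).unique ?_
    have : ∀ k, α k x = 0 := fun k => hαT k x fun h => hx (Set.mem_iUnion.2 ⟨k, h⟩)
    simp [this, hasSum_zero]
  · have := le_hasSum (hφ1 x) 0 fun j _ => mul_nonneg (hc0 j) (hα0 j x)
    exact (one_le_mul_of_one_le_of_one_le (hc1 0) (hαU 0 x hx)).trans this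
  · by_cases h : ∃ k, x ∈ N k
    · obtain ⟨k, hk⟩ := h
      exact hin k x hk
    · push Not at h
      have := le_hasSum (hφ2 x) 0 fun j _ => hout x h j
      exact (one_le_mul_of_one_le_of_one_le (hc1 0) (hAU 0 x ⟨hx, h 0⟩)).trans this

end LocallyFiniteSum

/-! ### Large subsolutions near a closed set without compact components. -/

section ClosedSet

variable {n : ℕ} {M : Type*} [TopologicalSpace M] [T2Space M] [SecondCountableTopology M]
    [ChartedSpace (EuclideanSpace ℝ (Fin n)) M] [IsManifold (𝓡 n) ∞ M]
    {A : C^∞⟮𝓡 n, M; ℝ⟯ → M → ℝ}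

lemma IsLocallyUniformlyElliptic.exists_locallyFinite_cells [LocallyCompactSpace M]
    (hA : IsLocallyUniformlyElliptic A) {D W : Set M} (hD : IsClosed D) (hW : IsOpen W)
    (hDW : D ⊆ W) :
    ∃ (s : Set (ℕ × M)) (U T : s → Set M), s.Countable ∧ (∀ i, IsCell A (U i) (T i)) ∧
      (∀ i, T i ⊆ W) ∧ D ⊆ ⋃ i, U i ∧ LocallyFinite T ∧ ∀ i, (U i ∩ D).Nonempty := by
  let K : CompactExhaustion M := (CompactExhaustion.choice M).shiftr
  have hK0 : K 0 = ∅ := rfl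
  let L : ℕ → Set M := fun k => D ∩ (K (k + 1) \ interior (K k))
  have hL : ∀ k, IsCompact (L k) := fun k =>
    ((K.isCompact (k + 1)).diff isOpen_interior).inter_left hD
  -- Cells centred in the `k`-th shell avoid `K (k - 1)`, which forces local finiteness. The shifted
  -- exhaustion has `K 0 = ∅`, so truncated subtraction at `k = 0` does no harm.
  let O : ℕ → Set M := fun k => W ∩ (K (k - 1))ᶜ
  have hO : ∀ k, IsOpen (O k) := fun k => hW.inter (K.isCompact _).isClosed.isOpen_compl
  have hLO : ∀ k, L k ⊆ O k := fun k x hx => by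
    refine ⟨hDW hx.1, fun hxK => ?_⟩
    rcases k with _ | k
    · simp [hK0] at hxK
    · exact hx.2.2 (K.subset_interior_succ k hxK)
  have hcell : ∀ k x, ∃ U T, x ∈ L k → IsCell A U T ∧ x ∈ U ∧ T ⊆ O k := fun k x => by
    by_cases hx : x ∈ L k
    · obtain ⟨U, T, h⟩ := hA.exists_isCell ((hO k).mem_nhds (hLO k hx))
      exact ⟨U, T, fun _ => h⟩
    · exact ⟨∅, ∅, fun h => absurd h hx⟩
  choose U T hUT using hcell
  have hsub : ∀ k, ∃ t : Finset M, (∀ x ∈ t, x ∈ L k) ∧ L k ⊆ ⋃ x ∈ t, U k x := fun k =>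
    (hL k).elim_nhds_subcover (U k) fun x hx =>
      (hUT k x hx).1.isOpen.mem_nhds (hUT k x hx).2.1
  choose t ht1 ht2 using hsub
  have hfin : ∀ k, {p : ℕ × M | p.1 ≤ k ∧ p.2 ∈ t p.1}.Finite := fun k => by
    refine (((Set.finite_Iic k).biUnion fun j _ =>
      ((t j).finite_toSet.image (Prod.mk j)))).subset ?_
    rintro ⟨j, x⟩ ⟨hj, hx⟩
    exact Set.mem_biUnion (show j ∈ Set.Iic k from hj) ⟨x, hx, rfl⟩
  refine ⟨{p | p.2 ∈ t p.1}, fun i => U i.1.1 i.1.2, fun i => T i.1.1 i.1.2, ?_,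
    fun i => (hUT _ _ (ht1 _ _ i.2)).1, fun i => (hUT _ _ (ht1 _ _ i.2)).2.2.trans
      Set.inter_subset_left, fun x hx => ?_, fun x => ?_,
    fun i => ⟨i.1.2, (hUT _ _ (ht1 _ _ i.2)).2.1, (ht1 _ _ i.2).1⟩⟩
  · refine (Set.countable_iUnion fun k => (hfin k).countable).mono fun p hp => ?_
    exact Set.mem_iUnion.2 ⟨p.1, le_rfl, hp⟩
  · obtain ⟨k, hk⟩ : ∃ k, K.find x = k + 1 := by
      refine Nat.exists_eq_succ_of_ne_zero fun h => ?_
      have := K.mem_find x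
      simp [h, hK0] at this
    have hxL : x ∈ L k := ⟨hx, K.mem_iff_find_le.2 hk.le, fun h => by
      have := K.mem_iff_find_le.1 (interior_subset h)
      omega⟩
    obtain ⟨y, hy, hxy⟩ := Set.mem_iUnion₂.1 (ht2 k hxL)
    exact Set.mem_iUnion.2 ⟨⟨(k, y), hy⟩, hxy⟩
  · obtain ⟨k, hk⟩ := K.exists_mem_nhds x
    refine ⟨K k, hk, ((hfin k).preimage Subtype.val_injective.injOn).subset ?_⟩
    rintro ⟨⟨j, y⟩, hy⟩ ⟨z, hz1, hz2⟩
    refine ⟨?_, hy⟩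
    have hz3 := ((hUT _ _ (ht1 _ _ hy)).2.2 hz1).2
    by_contra! hlt
    exact hz3 (K.subset (show k ≤ j - 1 from Nat.le_sub_one_of_lt hlt) hz2)

/-- A closed set without compact components carries arbitrarily large subsolutions supported in a
given neighbourhood. -/
lemma IsLocallyUniformlyElliptic.exists_subsolution_large_on [LocallyCompactSpace M]
    [∀ x : M, (𝓝[≠] x).NeBot] (hA : IsLocallyUniformlyElliptic A)
    {D W : Set M} (hD : IsClosed D) (hW : IsOpen W) (hDW : D ⊆ W)
    (hDc : ∀ x ∈ D, ¬ IsCompact (connectedComponentIn D x)) {ρ : M → ℝ} (hρ : Continuous ρ) :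
    ∃ φ : C^∞⟮𝓡 n, M; ℝ⟯, (∀ x, 0 ≤ φ x) ∧ (∀ x, 0 ≤ A φ x) ∧ (∀ x ∉ W, φ x = 0) ∧
      ∃ N, IsOpen N ∧ D ⊆ N ∧ ∀ x ∈ N, ρ x < φ x ∧ ρ x < A φ x := by
  obtain ⟨s, U, T, hs, hcell, hTW, hDU, hT, hUD⟩ := hA.exists_locallyFinite_cells hD hW hDW
  have : Countable s := hs
  let G : s → s → Prop := fun i j => i ≠ j ∧ (U i ∩ U j).Nonempty
  have hGs : ∀ ⦃i j⦄, G i j → G j i := fun i j h => ⟨h.1.symm, by rw [Set.inter_comm]; exact h.2⟩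
  have hGf : ∀ i, {j | G i j}.Finite := fun i =>
    (hT.finite_nonempty_inter_compact (hcell i).isCompact).subset fun j hj =>
      hj.2.mono fun x hx => ⟨(hcell j).subset hx.2, (hcell i).subset hx.1⟩
  have hGi : ∀ i, {j | ReachAvoiding G ∅ i j}.Infinite := fun i hfin => by
    obtain ⟨x, hxU, hxD⟩ := hUD i
    -- Cells reachable from `i` are disjoint from the others, so connectedness keeps the component
    -- of `x` among the reachable ones. If these were finitely many, the component would be closed
    -- in a compact set.
    have hsub : connectedComponentIn D x ⊆ ⋃ j ∈ {j | ReachAvoiding G ∅ i j}, U j := by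
      refine IsPreconnected.subset_left_of_subset_union
        (v := ⋃ j ∈ {j | ReachAvoiding G ∅ i j}ᶜ, U j)
        (isOpen_biUnion fun j _ => (hcell j).isOpen) (isOpen_biUnion fun j _ => (hcell j).isOpen)
        ?_ ?_ ⟨x, mem_connectedComponentIn hxD, Set.mem_biUnion (by exact .refl) hxU⟩
        isPreconnected_connectedComponentIn
      · refine Set.disjoint_left.2 fun z hz1 hz2 => ?_
        obtain ⟨j, hj, hzj⟩ := Set.mem_iUnion₂.1 hz1
        obtain ⟨k, hk, hzk⟩ := Set.mem_iUnion₂.1 hz2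
        refine hk (Relation.ReflTransGen.tail hj ⟨⟨?_, z, hzj, hzk⟩, by simp⟩)
        rintro rfl
        exact hk hj
      · intro y hy
        obtain ⟨j, hj⟩ := Set.mem_iUnion.1 (hDU (connectedComponentIn_subset _ _ hy))
        by_cases h : j ∈ {j | ReachAvoiding G ∅ i j}
        · exact .inl (Set.mem_biUnion h hj)
        · exact .inr (Set.mem_biUnion (show j ∈ {j | ReachAvoiding G ∅ i j}ᶜ from h) hj)
    exact hDc x hxD ((hfin.isCompact_biUnion fun j _ => (hcell j).isCompact).of_isClosed_subset
      (hD.connectedComponentIn x) (hsub.trans (Set.iUnion₂_mono fun j _ => (hcell j).subset)))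
  obtain ⟨P, hP0, hPadj, hPinj, hPfin⟩ := exists_locallyFinite_rays hGs hGf hGi
  choose f hf0 hAf0 hfT hfU using fun i => hA.exists_subsolution_of_chain
    (fun k => hcell (P i k)) (hT.comp_injective (hPinj i)) (fun k => (hPadj i k).2)
  have hbd : ∀ i, ∃ c : ℝ, 0 < c ∧ ∀ x ∈ T i, ρ x < c := fun i => by
    obtain ⟨c, hc⟩ := (hcell i).isCompact.bddAbove_image hρ.continuousOn
    exact ⟨max c 0 + 1, by positivity, fun x hx =>
      ((hc ⟨x, hx, rfl⟩).trans (le_max_left _ _)).trans_lt (lt_add_one _)⟩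
  choose c hc0 hc using hbd
  -- A small neighbourhood meets finitely many cells, and each cell lies on finitely many rays.
  have hS : LocallyFinite fun i => ⋃ k, T (P i k) := fun x => by
    obtain ⟨V, hV, hVf⟩ := hT x
    refine ⟨V, hV, (hVf.biUnion fun w _ => hPfin w).subset ?_⟩
    rintro i ⟨z, hz, hzV⟩
    obtain ⟨k, hk⟩ := Set.mem_iUnion.1 hz
    exact Set.mem_biUnion (show P i k ∈ {w | (T w ∩ V).Nonempty} from ⟨z, hk, hzV⟩) ⟨k, rfl⟩
  obtain ⟨φ, hφ⟩ := hA.exists_hasSum_of_locallyFinite (fun i => c i • f i) hS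
    (fun i x hx => by simp [hfT i x hx])
  have hφ1 : ∀ x, HasSum (fun i => c i * f i x) (φ x) := fun x => (hφ x).1
  have hφ2 : ∀ x, HasSum (fun i => c i * A (f i) x) (A φ x) := fun x => by
    simpa only [hA.map_smul] using (hφ x).2
  have nn1 : ∀ x i, 0 ≤ c i * f i x := fun x i => mul_nonneg (hc0 i).le (hf0 i x)
  have nn2 : ∀ x i, 0 ≤ c i * A (f i) x := fun x i => mul_nonneg (hc0 i).le (hAf0 i x)
  refine ⟨φ, fun x => HasSum.nonneg (nn1 x) (hφ1 x), fun x => HasSum.nonneg (nn2 x) (hφ2 x),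
    fun x hx => ?_, ⋃ i, U i, isOpen_iUnion fun i => (hcell i).isOpen, hDU, fun x hx => ?_⟩
  · refine (hφ1 x).unique ?_
    have : ∀ i, f i x = 0 := fun i => hfT i x fun h => by
      obtain ⟨k, hk⟩ := Set.mem_iUnion.1 h
      exact hx (hTW _ hk)
    simp [this, hasSum_zero]
  · obtain ⟨i, hi⟩ := Set.mem_iUnion.1 hx
    have hρi := hc i x ((hcell i).subset hi)
    obtain ⟨h1, h2⟩ := hfU i x (by rwa [hP0])
    exact ⟨hρi.trans_le ((le_mul_of_one_le_right (hc0 i).le h1).trans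
        (le_hasSum (hφ1 x) i fun j _ => nn1 x j)),
      hρi.trans_le ((le_mul_of_one_le_right (hc0 i).le h2).trans
        (le_hasSum (hφ2 x) i fun j _ => nn2 x j))⟩

end ClosedSet

/-! ### Smoothly convergent series with small positive coefficients. -/

section SmoothSeries

variable {n : ℕ}

/-- A series of smooth functions on `ℝⁿ` all of whose derivatives are uniformly summable. -/
def SmoothlySummable (h : ℕ → EuclideanSpace ℝ (Fin n) → ℝ) : Prop :=
  (∀ m, ContDiff ℝ ∞ (h m)) ∧ ∃ u : ℕ → ℕ → ℝ, (∀ k, Summable (u k)) ∧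
    ∀ k m y, ‖iteratedFDeriv ℝ k (h m) y‖ ≤ u k m

namespace SmoothlySummable

variable {h : ℕ → EuclideanSpace ℝ (Fin n) → ℝ}

lemma summable (hh : SmoothlySummable h) (y : EuclideanSpace ℝ (Fin n)) :
    Summable fun m => h m y := by
  obtain ⟨-, u, hu, hb⟩ := hh
  exact (hu 0).of_norm_bounded fun m => by simpa using hb 0 m y

lemma contDiff_tsum (hh : SmoothlySummable h) : ContDiff ℝ ∞ fun y => ∑' m, h m y := by
  obtain ⟨hs, u, hu, hb⟩ := hh
  exact _root_.contDiff_tsum hs (fun k _ => hu k) fun k m y _ => hb k m y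

/-- Differentiation shifts the bounds by one order; since bounds of every order are assumed, it can
be iterated. -/
lemma partialDeriv (hh : SmoothlySummable h) (i : Fin n) :
    SmoothlySummable fun m => partialDeriv i (h m) := by
  obtain ⟨hs, u, hu, hb⟩ := hh
  refine ⟨fun m => contDiff_iff_contDiffAt.2 fun y => (hs m).contDiffAt.partialDeriv i,
    fun k => u (k + 1), fun k => hu (k + 1), fun k m y => ?_⟩
  have hd : ContDiffAt ℝ ∞ (fderiv ℝ (h m)) y := (hs m).contDiffAt.fderiv_right (by simp)
  refine (norm_iteratedFDeriv_clm_apply_const hd (by exact_mod_cast le_top)).trans ?_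
  rw [norm_iteratedFDeriv_fderiv]
  simpa using hb (k + 1) m y

lemma partialDeriv_tsum (hh : SmoothlySummable h) (i : Fin n) :
    _root_.partialDeriv i (fun y => ∑' m, h m y) = fun y => ∑' m, _root_.partialDeriv i (h m) y := by
  have hsum := hh.summable
  obtain ⟨hs, u, hu, hb⟩ := hh
  have hb1 : ∀ m y, ‖fderiv ℝ (h m) y‖ ≤ u 1 m := fun m y => by
    rw [← norm_iteratedFDeriv_one]; exact hb 1 m y
  ext y
  rw [_root_.partialDeriv, fderiv_tsum_apply (hu 1) (fun m => (hs m).differentiable (by simp)) hb1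
    (hsum 0)]
  exact ((hu 1).of_norm_bounded fun m => hb1 m y).map_tsum
    (ContinuousLinearMap.apply ℝ ℝ (EuclideanSpace.single i 1)) (by fun_prop) |>.trans rfl

lemma hasSum_secondOrder (hh : SmoothlySummable h) (a : Matrix (Fin n) (Fin n) ℝ) (b : Fin n → ℝ)
    (c : ℝ) (y : EuclideanSpace ℝ (Fin n)) :
    HasSum (fun m => secondOrder a b c (h m) y) (secondOrder a b c (fun y => ∑' m, h m y) y) := by
  have h1 : ∀ i, HasSum (fun m => _root_.partialDeriv i (h m) y)
      (_root_.partialDeriv i (fun y => ∑' m, h m y) y) := fun i => by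
    rw [hh.partialDeriv_tsum]
    exact ((hh.partialDeriv i).summable y).hasSum
  have h2 : ∀ i j, HasSum (fun m => _root_.partialDeriv i (_root_.partialDeriv j (h m)) y)
      (_root_.partialDeriv i (_root_.partialDeriv j (fun y => ∑' m, h m y)) y) := fun i j => by
    rw [hh.partialDeriv_tsum, (hh.partialDeriv j).partialDeriv_tsum]
    exact (((hh.partialDeriv j).partialDeriv i).summable y).hasSum
  exact ((hasSum_sum fun i _ => hasSum_sum fun j _ => (h2 i j).mul_left (a i j)).add
    (hasSum_sum fun i _ => (h1 i).mul_left (b i))).add ((hh.summable y).hasSum.mul_left c)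

end SmoothlySummable

/-- Countably many families of smooth compactly supported functions can be made smoothly summable by
a common choice of small positive coefficients. -/
lemma exists_pos_smoothlySummable (g : ℕ → ℕ → EuclideanSpace ℝ (Fin n) → ℝ)
    (hg : ∀ j m, ContDiff ℝ ∞ (g j m)) (hc : ∀ j m, HasCompactSupport (g j m)) :
    ∃ ε : ℕ → ℝ, (∀ m, 0 < ε m) ∧ ∀ j, SmoothlySummable fun m => ε m • g j m := by
  have hbd : ∀ j m k, ∃ C, ∀ y, ‖iteratedFDeriv ℝ k (g j m) y‖ ≤ C := fun j m k =>
    ((hg j m).continuous_iteratedFDeriv (by exact_mod_cast le_top)).bounded_above_of_compact_support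
      ((hc j m).iteratedFDeriv k)
  choose C hC using hbd
  have hC0 : ∀ j m k, 0 ≤ C j m k := fun j m k => (norm_nonneg _).trans (hC j m k 0)
  -- Diagonal choice: `S m` dominates `C j m k` for `j, k ≤ m`, so for fixed `j` and `k` all but
  -- finitely many terms are bounded by 2⁻ᵐ.
  let S : ℕ → ℝ := fun m => 1 + ∑ j ∈ Finset.range (m + 1), ∑ k ∈ Finset.range (m + 1), C j m k
  have hS1 : ∀ m, 1 ≤ S m := fun m => by
    have : 0 ≤ ∑ j ∈ Finset.range (m + 1), ∑ k ∈ Finset.range (m + 1), C j m k :=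
      Finset.sum_nonneg fun j _ => Finset.sum_nonneg fun k _ => hC0 j m k
    simp only [S]
    linarith
  have hS0 : ∀ m, 0 < S m := fun m => zero_lt_one.trans_le (hS1 m)
  have hS : ∀ j m k, j ≤ m → k ≤ m → C j m k ≤ S m := fun j m k hj hk => by
    have h1 : C j m k ≤ ∑ k ∈ Finset.range (m + 1), C j m k :=
      Finset.single_le_sum (f := fun k => C j m k) (fun k _ => hC0 j m k)
        (Finset.mem_range.2 (by omega))
    have h2 : ∑ k ∈ Finset.range (m + 1), C j m k ≤
        ∑ j ∈ Finset.range (m + 1), ∑ k ∈ Finset.range (m + 1), C j m k :=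
      Finset.single_le_sum (f := fun j => ∑ k ∈ Finset.range (m + 1), C j m k)
        (fun j _ => Finset.sum_nonneg fun k _ => hC0 j m k) (Finset.mem_range.2 (by omega))
    simp only [S]
    linarith
  refine ⟨fun m => (1 / 2) ^ m / S m, fun m => div_pos (by positivity) (hS0 m), fun j =>
    ⟨fun m => (hg j m).const_smul ((1 / 2) ^ m / S m), fun k m => (1 / 2) ^ m / S m * C j m k, fun k => ?_,
      fun k m y => ?_⟩⟩
  · refine Summable.of_norm_bounded_eventually_nat summable_geometric_two ?_
    filter_upwards [Filter.eventually_ge_atTop j, Filter.eventually_ge_atTop k] with m hj hk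
    rw [Real.norm_of_nonneg (mul_nonneg (div_nonneg (by positivity) (hS0 m).le) (hC0 j m k)),
      div_mul_eq_mul_div, div_le_iff₀ (hS0 m)]
    exact mul_le_mul_of_nonneg_left (hS j m k hj hk) (by positivity)
  · have h0 : 0 ≤ (1 / 2 : ℝ) ^ m / S m := div_nonneg (by positivity) (hS0 m).le
    rw [iteratedFDeriv_const_smul_apply ((hg j m).contDiffAt.of_le (by exact_mod_cast le_top)),
      norm_smul, Real.norm_of_nonneg h0]
    exact mul_le_mul_of_nonneg_left (hC j m k y) h0

variable {M : Type*} [TopologicalSpace M] [T2Space M] [SecondCountableTopology M]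
    [ChartedSpace (EuclideanSpace ℝ (Fin n)) M] [IsManifold (𝓡 n) ∞ M]
    {A : C^∞⟮𝓡 n, M; ℝ⟯ → M → ℝ}

/-- Near any point, the coordinate expressions of smooth functions are the restrictions of smooth
compactly supported functions on `ℝⁿ`. -/
lemma exists_compactly_supported_extension [LocallyCompactSpace M]
    {e : OpenPartialHomeomorph M (EuclideanSpace ℝ (Fin n))}
    (he : e ∈ IsManifold.maximalAtlas (𝓡 n) ∞ M) {p : M} (hp : p ∈ e.source) :
    ∃ V : Set M, IsOpen V ∧ p ∈ V ∧ V ⊆ e.source ∧ ∀ f : C^∞⟮𝓡 n, M; ℝ⟯,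
      ∃ g : EuclideanSpace ℝ (Fin n) → ℝ, ContDiff ℝ ∞ g ∧ HasCompactSupport g ∧
        ∀ x ∈ V, g (e x) = f x := by
  obtain ⟨Q, hQ, hpQ, hQe⟩ := exists_compact_subset e.open_source hp
  obtain ⟨χ, hχ1, hχ0, -⟩ := exists_contMDiffMap_one_nhds_of_subset_interior (n := (⊤ : ℕ∞)) (𝓡 n)
    (isClosed_singleton (x := p)) (t := Q) (by simpa using hpQ)
  rw [nhdsSet_singleton] at hχ1
  obtain ⟨V, hV, hVo, hpV⟩ := mem_nhds_iff.1 hχ1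
  refine ⟨V ∩ e.source, hVo.inter e.open_source, ⟨hpV, hp⟩, Set.inter_subset_right, fun f => ?_⟩
  have heQ : IsCompact (e '' Q) := hQ.image_of_continuousOn (e.continuousOn.mono hQe)
  let g : EuclideanSpace ℝ (Fin n) → ℝ := e.target.indicator ((χ * f) ∘ e.symm)
  have hgt : ∀ y ∈ e.target, g y = χ (e.symm y) * f (e.symm y) := fun y hy =>
    Set.indicator_of_mem hy _
  have hg0 : ∀ y ∉ e '' Q, g y = 0 := fun y hy => by
    by_cases hyt : y ∈ e.target
    · rw [hgt y hyt, hχ0 _ fun h => hy ⟨_, h, e.right_inv hyt⟩, zero_mul]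
    · exact Set.indicator_of_notMem hyt _
  refine ⟨g, contDiff_iff_contDiffAt.2 fun y => ?_, HasCompactSupport.intro heQ hg0, ?_⟩
  · by_cases hy : y ∈ e '' Q
    · have hyt : y ∈ e.target := by
        obtain ⟨x, hx, rfl⟩ := hy
        exact e.map_source (hQe hx)
      refine (contDiffAt_comp_chart_symm he (χ * f).contMDiff hyt).congr_of_eventuallyEq ?_
      exact Filter.eventually_of_mem (e.open_target.mem_nhds hyt) fun z hz => hgt z hz
    · exact (contDiffAt_const (c := (0 : ℝ))).congr_of_eventuallyEq
        (Filter.eventually_of_mem (heQ.isClosed.isOpen_compl.mem_nhds hy) hg0)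
  · rintro x ⟨hxV, hxs⟩
    rw [hgt _ (e.map_source hxs), e.left_inv hxs, show χ x = 1 from hV hxV, one_mul]

/-- Any sequence of smooth functions has a smoothly convergent combination with positive
coefficients, to which the operator applies termwise. -/
lemma IsLocallyUniformlyElliptic.exists_pos_hasSum [LocallyCompactSpace M] [Nonempty M]
    (hA : IsLocallyUniformlyElliptic A) (f : ℕ → C^∞⟮𝓡 n, M; ℝ⟯) :
    ∃ (ε : ℕ → ℝ) (φ : C^∞⟮𝓡 n, M; ℝ⟯), (∀ m, 0 < ε m) ∧ ∀ x,
      HasSum (fun m => ε m * f m x) (φ x) ∧ HasSum (fun m => ε m * A (f m) x) (A φ x) := by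
  choose e he hpe a b c hform using hA
  -- The set `V p` does not depend on the function being extended, so countably many such sets serve
  -- the whole sequence and the diagonal choice applies.
  choose V hVo hpV hVe hext using fun p => exists_compactly_supported_extension (he p) (hpe p)
  obtain ⟨s, hs, hsV⟩ := TopologicalSpace.countable_cover_nhds fun p => (hVo p).mem_nhds (hpV p)
  have hsne : s.Nonempty := by
    obtain ⟨x⟩ := ‹Nonempty M›
    obtain ⟨p, hp, -⟩ := Set.mem_iUnion₂.1 (hsV.symm ▸ Set.mem_univ x)
    exact ⟨p, hp⟩
  obtain ⟨p, rfl⟩ := hs.exists_eq_range hsne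
  have hcov : ∀ x, ∃ j, x ∈ V (p j) := fun x => by
    obtain ⟨_, ⟨j, rfl⟩, hj⟩ := Set.mem_iUnion₂.1 (hsV.symm ▸ Set.mem_univ x)
    exact ⟨j, hj⟩
  choose g hg hgc hgV using fun j m => hext (p j) (f m)
  obtain ⟨ε, hε, hsum⟩ := exists_pos_smoothlySummable g hg hgc
  have hφV : ∀ j, ∀ x ∈ V (p j), ∑' m, ε m * f m x = ∑' m, (ε m • g j m) (e (p j) x) :=
    fun j x hx => tsum_congr fun m => by
      rw [Pi.smul_apply, hgV j m x hx, smul_eq_mul]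
  let φ : C^∞⟮𝓡 n, M; ℝ⟯ := ⟨fun x => ∑' m, ε m * f m x, fun x => by
    obtain ⟨j, hj⟩ := hcov x
    have h1 : ContMDiffOn (𝓡 n) 𝓘(ℝ) ∞ ((fun y => ∑' m, (ε m • g j m) y) ∘ e (p j))
        (e (p j)).source :=
      (hsum j).contDiff_tsum.contMDiff.comp_contMDiffOn (contMDiffOn_of_mem_maximalAtlas (he _))
    exact (h1.contMDiffAt ((e _).open_source.mem_nhds (hVe _ hj))).congr_of_eventuallyEq
      (Filter.eventually_of_mem ((hVo _).mem_nhds hj) (hφV j))⟩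
  refine ⟨ε, φ, hε, fun x => ?_⟩
  obtain ⟨j, hj⟩ := hcov x
  have hxs := hVe _ hj
  constructor
  · have := (hsum j).summable (e (p j) x)
    simp only [Pi.smul_apply, hgV j _ x hj, smul_eq_mul] at this
    exact this.hasSum
  · have hnear : ∀ᶠ y in 𝓝 (e (p j) x), y ∈ (e (p j)).target ∧ (e (p j)).symm y ∈ V (p j) := by
      refine Filter.Eventually.and ((e _).open_target.mem_nhds ((e _).map_source hxs)) ?_
      refine ((e (p j)).continuousAt_symm ((e _).map_source hxs)).eventually ?_
      rw [(e _).left_inv hxs]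
      exact (hVo _).mem_nhds hj
    have hAφ : A φ x = secondOrder (a (p j) x) (b (p j) x) (c (p j) x)
        (fun y => ∑' m, (ε m • g j m) y) (e (p j) x) := by
      rw [(hform (p j)).apply_eq_secondOrder φ hxs]
      refine secondOrder_congr _ _ _ (hnear.mono fun y hy => ?_)
      exact (hφV j _ hy.2).trans (by rw [(e _).right_inv hy.1])
    have hAf : ∀ m, ε m * A (f m) x = secondOrder (a (p j) x) (b (p j) x) (c (p j) x)
        (ε m • g j m) (e (p j) x) := fun m => by
      rw [(hform (p j)).apply_eq_secondOrder (f m) hxs,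
        secondOrder_const_smul _ _ _ (hg j m).contDiffAt]
      congr 1
      refine secondOrder_congr _ _ _ (hnear.mono fun y hy => ?_)
      rw [Function.comp_apply, ← hgV j m _ hy.2, (e _).right_inv hy.1]
    rw [hAφ]
    simp only [hAf]
    exact (hsum j).hasSum_secondOrder _ _ _ _

end SmoothSeries

/-! ### Assembly of the final function. -/

/-- A point of an open set `W` whose component contains a closed connected noncompact set lies in
such a set inside `W`. -/
lemma exists_isClosed_isConnected_not_isCompact {X : Type*} [TopologicalSpace X] [T2Space X]
    [LocallyPathConnectedSpace X] {W : Set X} (hW : IsOpen W) {x : X} (hx : x ∈ W) {C : Set X}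
    (hCW : C ⊆ connectedComponentIn W x) (hC : IsConnected C) (hCcl : IsClosed C)
    (hCc : ¬ IsCompact C) :
    ∃ D ⊆ W, x ∈ D ∧ IsConnected D ∧ IsClosed D ∧ ¬ IsCompact D := by
  obtain ⟨y, hy⟩ := hC.nonempty
  have hpath : IsPathConnected (connectedComponentIn W x) :=
    hW.connectedComponentIn.isConnected_iff_isPathConnected.1
      (isConnected_connectedComponentIn_iff.2 hx)
  have hj := hpath.joinedIn y (hCW hy) x (mem_connectedComponentIn hx)
  set γ := hj.somePath
  have hγ : IsCompact (Set.range γ) := isCompact_range γ.continuous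
  refine ⟨C ∪ Set.range γ, Set.union_subset (hCW.trans (connectedComponentIn_subset _ _)) ?_,
    .inr ⟨1, γ.target⟩, IsConnected.union ⟨y, hy, ⟨0, γ.source⟩⟩ hC
      (isConnected_range γ.continuous), hCcl.union hγ.isClosed, fun h => ?_⟩
  · rintro _ ⟨t, rfl⟩
    exact connectedComponentIn_subset _ _ (hj.somePath_mem t)
  · exact hCc (h.of_isClosed_subset hCcl Set.subset_union_left)

theorem theorem1p13 {n : ℕ} {M : Type*} [TopologicalSpace M] [T2Space M]
    [SecondCountableTopology M] [ConnectedSpace M]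
    [ChartedSpace (EuclideanSpace ℝ (Fin n)) M] [IsManifold (𝓡 n) ∞ M]
    (A : C^∞⟮𝓡 n, M; ℝ⟯ → M → ℝ) (hA : IsLocallyUniformlyElliptic A)
    (K : Set M) (hK : IsClosed K)
    (hKc : ∀ x ∈ Kᶜ, ∃ C : Set M, C ⊆ connectedComponentIn Kᶜ x ∧
      IsConnected C ∧ IsClosed C ∧ ¬ IsCompact C)
    (D : Set M) (hD : IsClosed D) (hDK : D ⊆ Kᶜ)
    (hDc : ∀ x ∈ D, ¬ IsCompact (connectedComponentIn D x))
    (ρ : M → ℝ) (hρ : Continuous ρ) (hρ_pos : ∀ x, 0 < ρ x) :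
    ∃ φ : C^∞⟮𝓡 n, M; ℝ⟯,
      (∀ x, 0 ≤ φ x ∧ 0 ≤ A φ x) ∧
      (∀ x ∈ D, ρ x < φ x ∧ ρ x < A φ x) ∧
      (∀ x ∈ K, φ x = 0) ∧
      (∀ x ∈ Kᶜ, 0 < φ x) ∧
      (∀ E : Set M, IsCompact E → E ⊆ Kᶜ → ∃ δ : ℝ, 0 < δ ∧ ∀ x ∈ E, δ < A φ x) := by
  have : LocallyCompactSpace M := ChartedSpace.locallyCompactSpace (EuclideanSpace ℝ (Fin n)) M
  have : LocallyPathConnectedSpace M :=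
    ChartedSpace.locallyPathConnectedSpace (EuclideanSpace ℝ (Fin n)) M
  rcases Set.eq_empty_or_nonempty Kᶜ with hKe | ⟨x₀, hx₀⟩
  · have hD0 : D = ∅ := Set.subset_empty_iff.1 (hKe ▸ hDK)
    refine ⟨0, fun x => ⟨le_rfl, (hA.map_zero x).ge⟩, by simp [hD0], fun x _ => rfl, by simp [hKe],
      fun E _ hE => ⟨1, one_pos, fun x hx => ?_⟩⟩
    have := hE hx
    simp [hKe] at this
  -- A connected manifold with more than one point has no isolated points, as the disjointification
  -- of the failure sets requires.
  have : Nontrivial M := by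
    by_contra h
    rw [not_nontrivial_iff_subsingleton] at h
    obtain ⟨C, -, -, -, hC⟩ := hKc x₀ hx₀
    exact hC C.toFinite.isCompact
  have hW := hK.isOpen_compl
  have hloc : ∀ x ∈ Kᶜ, ∃ f : C^∞⟮𝓡 n, M; ℝ⟯, (∀ y, 0 ≤ f y) ∧ (∀ y, 0 ≤ A f y) ∧
      (∀ y ∉ Kᶜ, f y = 0) ∧ ∃ N, IsOpen N ∧ x ∈ N ∧ ∀ y ∈ N, 1 < f y ∧ 1 < A f y := fun x hx => by
    obtain ⟨C, h1, h2, h3, h4⟩ := hKc x hx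
    obtain ⟨D', hD'W, hxD', hcon, hcl, hnc⟩ :=
      exists_isClosed_isConnected_not_isCompact hW hx h1 h2 h3 h4
    obtain ⟨f, hf0, hAf, hfW, N, hN, hDN, hfN⟩ := hA.exists_subsolution_large_on hcl hW hD'W
      (fun y hy => by rwa [hcon.isPreconnected.connectedComponentIn hy])
      (continuous_const (y := (1 : ℝ)))
    exact ⟨f, hf0, hAf, hfW, N, hN, hDN hxD', hfN⟩
  choose! F hF0 hAF0 hFW N hNo hxN hFN using hloc
  obtain ⟨s, hsK, hs, hsN⟩ := TopologicalSpace.countable_cover_nhdsWithin (s := Kᶜ) (f := N)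
    fun x hx => mem_nhdsWithin_of_mem_nhds ((hNo x hx).mem_nhds (hxN x hx))
  have hsne : s.Nonempty := by
    obtain ⟨p, hp, -⟩ := Set.mem_iUnion₂.1 (hsN hx₀)
    exact ⟨p, hp⟩
  obtain ⟨p, rfl⟩ := hs.exists_eq_range hsne
  have hp : ∀ m, p m ∈ Kᶜ := fun m => hsK ⟨m, rfl⟩
  have hcov : ∀ x ∈ Kᶜ, ∃ m, x ∈ N (p m) := fun x hx => by
    obtain ⟨_, ⟨m, rfl⟩, hm⟩ := Set.mem_iUnion₂.1 (hsN hx)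
    exact ⟨m, hm⟩
  obtain ⟨ε, ψ, hε, hψ⟩ := hA.exists_pos_hasSum fun m => F (p m)
  -- `θ` provides the size on `D`, and `ψ` the positivity off `K`; both vanish on `K`, and neither
  -- spoils the inequalities of the other.
  obtain ⟨θ, hθ0, hAθ0, hθW, N', -, hDN', hθN⟩ := hA.exists_subsolution_large_on hD hW hDK hDc hρ
  have nn1 : ∀ x m, 0 ≤ ε m * F (p m) x := fun x m => mul_nonneg (hε m).le (hF0 _ (hp m) x)
  have nn2 : ∀ x m, 0 ≤ ε m * A (F (p m)) x := fun x m => mul_nonneg (hε m).le (hAF0 _ (hp m) x)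
  have hψ0 : ∀ x, 0 ≤ ψ x := fun x => (hψ x).1.nonneg (nn1 x)
  have hAψ0 : ∀ x, 0 ≤ A ψ x := fun x => (hψ x).2.nonneg (nn2 x)
  have hψN : ∀ m, ∀ x ∈ N (p m), ε m ≤ ψ x ∧ ε m ≤ A ψ x := fun m x hx =>
    ⟨(le_mul_of_one_le_right (hε m).le (hFN _ (hp m) x hx).1.le).trans
        (le_hasSum (hψ x).1 m fun j _ => nn1 x j),
      (le_mul_of_one_le_right (hε m).le (hFN _ (hp m) x hx).2.le).trans
        (le_hasSum (hψ x).2 m fun j _ => nn2 x j)⟩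
  have hadd : ∀ x, (θ + ψ) x = θ x + ψ x := fun x => rfl
  refine ⟨θ + ψ, fun x => ?_, fun x hx => ?_, fun x hx => ?_, fun x hx => ?_, fun E hE hEK => ?_⟩
  · rw [hadd, hA.map_add]
    exact ⟨add_nonneg (hθ0 x) (hψ0 x), add_nonneg (hAθ0 x) (hAψ0 x)⟩
  · rw [hadd, hA.map_add]
    obtain ⟨h1, h2⟩ := hθN x (hDN' hx)
    exact ⟨lt_add_of_lt_of_nonneg h1 (hψ0 x), lt_add_of_lt_of_nonneg h2 (hAψ0 x)⟩
  · have hx' : x ∉ Kᶜ := fun h => h hx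
    have : ∀ m, F (p m) x = 0 := fun m => hFW _ (hp m) x hx'
    have h0 : ψ x = 0 := (hψ x).1.unique (by simp [this, hasSum_zero])
    rw [hadd, hθW x hx', h0, add_zero]
  · obtain ⟨m, hm⟩ := hcov x hx
    rw [hadd]
    exact add_pos_of_nonneg_of_pos (hθ0 x) ((hε m).trans_le (hψN m x hm).1)
  · refine hE.induction_on (p := fun E => ∃ δ : ℝ, 0 < δ ∧ ∀ x ∈ E, δ < A (θ + ψ) x)
      ⟨1, one_pos, by simp⟩ (fun s t hst ⟨δ, hδ, h⟩ => ⟨δ, hδ, fun x hx => h x (hst hx)⟩)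
      (fun s t ⟨δ, hδ, h⟩ ⟨δ', hδ', h'⟩ => ⟨min δ δ', lt_min hδ hδ', ?_⟩) fun x hx => ?_
    · rintro x (hx | hx)
      · exact (min_le_left _ _).trans_lt (h x hx)
      · exact (min_le_right _ _).trans_lt (h' x hx)
    · obtain ⟨m, hm⟩ := hcov x (hEK hx)
      refine ⟨N (p m), mem_nhdsWithin_of_mem_nhds ((hNo _ (hp m)).mem_nhds hm), ε m / 2,
        half_pos (hε m), fun y hy => ?_⟩
      rw [hA.map_add]
      have := (hψN m y hy).2
      have := hAθ0 y
      have := hε m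
      linarith
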